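/- Let $g(t)=2^{1/4}e^{-\pi t^2}$ and, for a function or generalised function $y$ on $\mathbb{R}$ and $z=\tau+i\omega\in\mathbb{C}$, let $$\mathrm{Spec}_g(y)(z)=\left|\int_{\mathbb{R}} y(t)\,g(t-\tau)\,e^{-2i\pi\omega t}\,\mathrm{d}t\right|^2,$$ where for a generalised function the integral is read as the value of $y$ at the Schwartz function $t\mapsto g(t-\tau)e^{-2i\pi\omega t}$. Let $x:\mathbb{R}\to\mathbb{C}$ be a deterministic, locally integrable signal such that this integral converges absolutely for every $z$ (with $y=x$). Let $\xi$ be a complex white Gaussian noise, i.e. a random tempered distribution on $\mathbb{R}$ with $\mathbb{E}\exp(i\,\mathrm{Re}\langle\xi,\varphi\rangle)=\exp(-\|\varphi\|_{L^2}^2/4)$ for all complex-valued Schwartz functions $\varphi$; equivalently, the $\langle\xi,\varphi\rangle$ are jointly circularly symmetric complex Gaussian variables with $\mathbb{E}|\langle\xi,\varphi\rangle|^2=\|\varphi\|_{L^2}^2$. For $A\subset\mathbb{C}$, let $N(A)$ be the number of zeros of $\mathrm{Spec}_g(x+\xi)$ in $A$. Then $S=\mathrm{Spec}_g(x)$ is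 twice continuously differentiable on $\mathbb{C}\cong\mathbb{R}^2$, and the zeros of $\mathrm{Spec}_g(x+\xi)$ have as intensity function the continuous non-negative function $$\rho(z)=\left(1+S(z)+\frac{\Delta S(z)}{4\pi}\right)e^{-S(z)},\qquad z\in\mathbb{C},$$ where $\Delta$ is the Laplacian on $\mathbb{R}^2$. That is, for every bounded Borel set $A\subset\mathbb{C}$, $N(A)$ is a random variable (measurable up to a null set) and $$\mathbb{E}[N(A)]=\int_A\rho(z)\,\mathrm{d}z<\infty .$$ -/

import Mathlib

open MeasureTheory ProbabilityTheory SchwartzMap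
open scoped ENNReal

noncomputable section

namespace SpectrogramZeros

/-! ### The Gaussian window and its time-frequency shifts -/

/-- The Gaussian window `g(t) = 2^{1/4} e^{-π t²}`, normalised in `L²(ℝ)`. -/
def gaussWindow (t : ℝ) : ℝ := (2 : ℝ) ^ (1 / 4 : ℝ) * Real.exp (-Real.pi * t ^ 2)

/-- The function `t ↦ g(t - τ) e^{-2iπωt}`, where `z = τ + iω`. -/
def gaborFun (z : ℂ) (t : ℝ) : ℂ :=
  (gaussWindow (t - z.re) : ℂ) *
    Complex.exp (-(2 * Complex.I * (Real.pi : ℂ) * (z.im : ℂ) * (t : ℂ)))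

/-! The next lemmas show that `gaborFun z` is a Schwartz function. -/

theorem gaborFun_eq (z : ℂ) : ∃ a b c : ℂ, gaborFun z = fun t : ℝ =>
    a * Complex.exp (-(Real.pi : ℂ) * (t : ℂ) ^ 2 + b * (t : ℂ) + c) := by
  refine ⟨(((2 : ℝ) ^ (1 / 4 : ℝ) : ℝ) : ℂ),
    2 * (Real.pi : ℂ) * (z.re : ℂ) - 2 * Complex.I * (Real.pi : ℂ) * (z.im : ℂ),
    -(Real.pi : ℂ) * (z.re : ℂ) ^ 2, ?_⟩
  funext t
  simp only [gaborFun, gaussWindow]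
  rw [Complex.ofReal_mul, mul_assoc, Complex.ofReal_exp, ← Complex.exp_add]
  congr 2
  push_cast
  ring

theorem contDiff_gaborFun (z : ℂ) : ContDiff ℝ ((⊤ : ℕ∞) : WithTop ℕ∞) (gaborFun z) := by
  obtain ⟨a, b, c, h⟩ := gaborFun_eq z
  rw [h]
  have h1 : ContDiff ℝ ((⊤ : ℕ∞) : WithTop ℕ∞) (fun t : ℝ => (t : ℂ)) := Complex.ofRealCLM.contDiff
  exact contDiff_const.mul
    ((((contDiff_const.mul (h1.pow 2)).add (contDiff_const.mul h1)).add contDiff_const).cexp)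

theorem iteratedDeriv_quadExp (a b c : ℂ) (n : ℕ) : ∃ p : Polynomial ℂ,
    iteratedDeriv n (fun t : ℝ =>
      a * Complex.exp (-(Real.pi : ℂ) * (t : ℂ) ^ 2 + b * (t : ℂ) + c)) =
    fun t : ℝ => p.eval (t : ℂ) *
      Complex.exp (-(Real.pi : ℂ) * (t : ℂ) ^ 2 + b * (t : ℂ) + c) := by
  induction n with
  | zero => exact ⟨Polynomial.C a, by simp⟩
  | succ n ih =>
    obtain ⟨p, hp⟩ := ih
    refine ⟨Polynomial.derivative p +
      p * (Polynomial.C (-(2 * (Real.pi : ℂ))) * Polynomial.X + Polynomial.C b), ?_⟩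
    rw [iteratedDeriv_succ, hp]
    funext t
    have h1 : HasDerivAt (fun w : ℂ => p.eval w *
        Complex.exp (-(Real.pi : ℂ) * w ^ 2 + b * w + c))
        ((Polynomial.derivative p).eval (t : ℂ) *
          Complex.exp (-(Real.pi : ℂ) * (t : ℂ) ^ 2 + b * (t : ℂ) + c) +
          p.eval (t : ℂ) * (Complex.exp (-(Real.pi : ℂ) * (t : ℂ) ^ 2 + b * (t : ℂ) + c) *
            (-(Real.pi : ℂ) * (2 * (t : ℂ)) + b))) (t : ℂ) := by
      refine (p.hasDerivAt (t : ℂ)).mul (HasDerivAt.cexp ?_)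
      have h2 := ((hasDerivAt_pow 2 (t : ℂ)).const_mul (-(Real.pi : ℂ))).add
        ((hasDerivAt_id (t : ℂ)).const_mul b)
      refine (h2.add_const c).congr_deriv ?_
      norm_num
    rw [h1.comp_ofReal.deriv]
    simp
    ring

theorem pow_mul_quadExp_le (b c : ℂ) (k : ℕ) : ∃ C : ℝ, ∀ t : ℝ,
    |t| ^ k * ‖Complex.exp (-(Real.pi : ℂ) * (t : ℂ) ^ 2 + b * (t : ℂ) + c)‖ ≤ C := by
  refine ⟨(k.factorial : ℝ) * Real.exp ((|b.re| + 1) ^ 2 / (4 * Real.pi) + c.re), fun t => ?_⟩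
  have hpi := Real.pi_pos
  have hre : (-(Real.pi : ℂ) * (t : ℂ) ^ 2 + b * (t : ℂ) + c).re =
      -Real.pi * t ^ 2 + b.re * t + c.re := by
    have : (-(Real.pi : ℂ) * (t : ℂ) ^ 2 + b * (t : ℂ) + c) =
        ((-Real.pi * t ^ 2 : ℝ) : ℂ) + b * (t : ℂ) + c := by push_cast; ring
    rw [this, Complex.add_re, Complex.add_re, Complex.ofReal_re, Complex.re_mul_ofReal]
  rw [Complex.norm_exp, hre]
  have h1 : |t| ^ k ≤ (k.factorial : ℝ) * Real.exp |t| := by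
    have := Real.pow_div_factorial_le_exp |t| (abs_nonneg t) k
    rwa [div_le_iff₀' (by positivity)] at this
  calc |t| ^ k * Real.exp (-Real.pi * t ^ 2 + b.re * t + c.re)
      ≤ (k.factorial : ℝ) * Real.exp |t| * Real.exp (-Real.pi * t ^ 2 + b.re * t + c.re) := by
        gcongr
    _ = (k.factorial : ℝ) * Real.exp (|t| + (-Real.pi * t ^ 2 + b.re * t + c.re)) := by
        rw [mul_assoc, ← Real.exp_add]
    _ ≤ _ := by
        refine mul_le_mul_of_nonneg_left (Real.exp_le_exp.mpr ?_) (by positivity)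
        have h2 : b.re * t ≤ |b.re| * |t| := by
          rw [← abs_mul]; exact le_abs_self _
        have h3 : (|b.re| + 1) * |t| - Real.pi * |t| ^ 2 ≤ (|b.re| + 1) ^ 2 / (4 * Real.pi) := by
          rw [le_div_iff₀ (by positivity)]
          nlinarith [sq_nonneg (2 * Real.pi * |t| - (|b.re| + 1))]
        rw [sq_abs] at h3
        linarith

theorem decay_polynomial_mul_quadExp (b c : ℂ) (p : Polynomial ℂ) (k : ℕ) : ∃ C : ℝ, ∀ t : ℝ,
    |t| ^ k * ‖p.eval (t : ℂ) *
      Complex.exp (-(Real.pi : ℂ) * (t : ℂ) ^ 2 + b * (t : ℂ) + c)‖ ≤ C := by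
  induction p using Polynomial.induction_on' with
  | add p q hp hq =>
    obtain ⟨C, hC⟩ := hp
    obtain ⟨D, hD⟩ := hq
    refine ⟨C + D, fun t => ?_⟩
    rw [Polynomial.eval_add, add_mul]
    refine le_trans (mul_le_mul_of_nonneg_left (norm_add_le _ _) (by positivity)) ?_
    rw [mul_add]
    exact add_le_add (hC t) (hD t)
  | monomial n a =>
    obtain ⟨C, hC⟩ := pow_mul_quadExp_le b c (k + n)
    refine ⟨‖a‖ * C, fun t => ?_⟩
    refine le_trans (le_of_eq ?_) (mul_le_mul_of_nonneg_left (hC t) (norm_nonneg a))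
    simp only [Polynomial.eval_monomial, norm_mul, norm_pow, Complex.norm_real, Real.norm_eq_abs]
    ring

theorem decay_gaborFun (z : ℂ) (k n : ℕ) :
    ∃ C : ℝ, ∀ t : ℝ, ‖t‖ ^ k * ‖iteratedFDeriv ℝ n (gaborFun z) t‖ ≤ C := by
  obtain ⟨a, b, c, h⟩ := gaborFun_eq z
  obtain ⟨p, hp⟩ := iteratedDeriv_quadExp a b c n
  obtain ⟨C, hC⟩ := decay_polynomial_mul_quadExp b c p k
  refine ⟨C, fun t => ?_⟩
  rw [norm_iteratedFDeriv_eq_norm_iteratedDeriv, h, hp]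
  exact hC t

/-- The time-frequency shifted window `t ↦ g(t - τ) e^{-2iπωt}`, `z = τ + iω`, as a
Schwartz function. -/
def gaborAtom (z : ℂ) : 𝓢(ℝ, ℂ) where
  toFun := gaborFun z
  smooth' := contDiff_gaborFun z
  decay' := decay_gaborFun z

/-! ### Spectrograms -/

/-- `Spec_g(y)(τ + iω) = |∫ y(t) g(t - τ) e^{-2iπωt} dt|²` for a function `y : ℝ → ℂ`. -/
def spec (y : ℝ → ℂ) (z : ℂ) : ℝ :=
  ‖∫ t : ℝ, y t * (gaussWindow (t - z.re) : ℂ) *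
    Complex.exp (-(2 * Complex.I * (Real.pi : ℂ) * (z.im : ℂ) * (t : ℂ)))‖ ^ 2

/-- `Spec_g(u)` for a generalised signal `u`, i.e. a functional on test functions: the integral
of `u` against the shifted window becomes the value of `u` at that window. -/
def specGen (u : 𝓢(ℝ, ℂ) → ℂ) (z : ℂ) : ℝ := ‖u (gaborAtom z)‖ ^ 2

/-- The functional `φ ↦ ∫ y(t) φ(t) dt` of a function `y : ℝ → ℂ`. -/
def toFunctional (y : ℝ → ℂ) (φ : 𝓢(ℝ, ℂ)) : ℂ := ∫ t : ℝ, y t * φ t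

/-- The two definitions of the spectrogram agree on functions. -/
theorem specGen_toFunctional (y : ℝ → ℂ) : specGen (toFunctional y) = spec y := by
  funext z
  have h : ∀ t : ℝ, y t * gaborAtom z t = y t * (gaussWindow (t - z.re) : ℂ) *
      Complex.exp (-(2 * Complex.I * (Real.pi : ℂ) * (z.im : ℂ) * (t : ℂ))) :=
    fun t => (mul_assoc _ _ _).symm
  simp only [specGen, toFunctional, spec, h]

/-! ### Complex white Gaussian noise -/

/-- Complex white Gaussian noise: a random tempered distribution `ξ` with characteristic
functional `𝔼 exp(i Re⟨ξ, φ⟩) = exp(-‖φ‖²/4)` for all complex test functions `φ`, where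
`‖φ‖² = ∫ |φ|²`. Since `⟨ξ, ·⟩` is complex linear, this says that the family `⟨ξ, φ⟩` is a
circularly symmetric complex Gaussian one with `𝔼[⟨ξ, φ⟩ conj ⟨ξ, ψ⟩] = ∫ φ conj ψ`. -/
structure IsComplexWhiteNoise {Ω : Type*} [MeasurableSpace Ω] (μ : Measure Ω)
    (ξ : Ω → 𝓢'(ℝ, ℂ)) : Prop where
  measurable_apply : ∀ φ : 𝓢(ℝ, ℂ), Measurable fun ω => ξ ω φ
  charFun_apply : ∀ φ : 𝓢(ℝ, ℂ),
    ∫ ω, Complex.exp (Complex.I * (((ξ ω φ).re : ℝ) : ℂ)) ∂μ =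
      ((Real.exp (-(∫ t : ℝ, ‖φ t‖ ^ 2) / 4) : ℝ) : ℂ)

/-- The noisy signal `y = x + ξ`, for one realisation `ξ` of the noise. -/
def noisySignal (x : ℝ → ℂ) (ξ : 𝓢'(ℝ, ℂ)) (φ : 𝓢(ℝ, ℂ)) : ℂ := toFunctional x φ + ξ φ

/-! ### Point processes and intensities -/

/-- `N(A)`: the number of points of the configuration `Z` that lie in `A`. -/
def count (Z : Set ℂ) (A : Set ℂ) : ℝ≥0∞ := ((Z ∩ A).encard : ℝ≥0∞)

/-- `ρ : ℂ → ℝ₊` is an intensity function of the random configuration `Z`: it is the density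
with respect to Lebesgue measure of `A ↦ 𝔼[N(A)]`, that is, for every bounded Borel set `A`, the
number `N(A)` is a random variable (up to a null set), `ρ` is integrable on `A`, and
`𝔼[N(A)] = ∫_A ρ(z) dz`. -/
structure IsIntensity {Ω : Type*} [MeasurableSpace Ω] (μ : Measure Ω) (Z : Ω → Set ℂ)
    (ρ : ℂ → ℝ) : Prop where
  nonneg : ∀ z, 0 ≤ ρ z
  aemeasurable_count : ∀ A : Set ℂ, MeasurableSet A → Bornology.IsBounded A →
    AEMeasurable (fun ω => count (Z ω) A) μ
  integrableOn : ∀ A : Set ℂ, MeasurableSet A → Bornology.IsBounded A →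
    IntegrableOn ρ A volume
  lintegral_count : ∀ A : Set ℂ, MeasurableSet A → Bornology.IsBounded A →
    ∫⁻ ω, count (Z ω) A ∂μ = ENNReal.ofReal (∫ z in A, ρ z)

end SpectrogramZeros

end

/-!
# Zeros of the spectrogram of a signal in white noise

Up to the zero-free factor `gaborFactor z` and the conjugation `w = conj z`, the windowed transform
of a (generalised) signal `u` is the function `w ↦ u (fockAtom w)`, where
`fockAtom w = 2^{1/4} e^{-πt² + 2πtw - πw²/2}`. It is entire: for a tempered distribution because
`w ↦ fockAtom w` is holomorphic in the Schwartz topology (`hasDerivAt_apply_gaussShift`), and for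
the deterministic signal by differentiation under the integral sign. The zeros to be counted are
therefore those of `M + Ξ`, with `M` entire and deterministic and `Ξ w = ⟨ξ, fockAtom w⟩` the
Gaussian entire function with covariance `e^{π w conj w'}` (`l2Inner_fockAtom`).

Let `ζ = Ξ 0`. Every `fockAtom w - fockAtom 0` is orthogonal to `fockAtom 0`, so `Ξ = ζ + Ξ₀`, where
`Ξ₀` is a random entire function independent of the standard complex Gaussian `ζ`. The zeros are the
solutions of `f w = ζ` with `f = -(M + Ξ₀)`. Conditionally on `Ξ₀`, averaging over `ζ` and applying
the area formula (`lintegral_encard_fiber`) to `f` gives, with no limiting procedure,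
`𝔼[N(A) | Ξ₀] = ∫_A |f'|² e^{-|f|²} / π`. For each `w ≠ 0` the expectation of the integrand is a
Gaussian integral in the pair `(Ξ₀ w, Ξ₀' w)`: splitting `Ξ₀' w` into its regression on `Ξ₀ w` and
an independent residual (`IsComplexWhiteNoise.lintegral_jacobian`), it equals
`(1 + e^{-π|w|²} |M' w - π conj w M w|² / π) e^{-S}` with `S = |M w|² e^{-π|w|²}`. Computing the
Laplacian of `S` (`laplacian_fockSpec`) identifies this with the stated density, and shows that the
density is non-negative.

The count `N(A)` is measurable because, for compact `A`, having at least `k` zeros means that some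
`k`-tuple of separated points makes a continuous random function vanish; Borel sets follow by a
π-λ argument (`measurable_count_zeros`).
-/

namespace SpectrogramZeros

/-! ### The area formula for entire functions -/

theorem hasFDerivAt_restrictScalars {f : ℂ → ℂ} (hf : Differentiable ℂ f) (z : ℂ) :
    HasFDerivAt f
      ((ContinuousLinearMap.toSpanSingleton ℂ (deriv f z)).restrictScalars ℝ) z :=
  ((hf z).hasDerivAt.hasFDerivAt).restrictScalars ℝ

theorem det_restrictScalars_toSpanSingleton (a : ℂ) :
    ((ContinuousLinearMap.toSpanSingleton ℂ a).restrictScalars ℝ).det = ‖a‖ ^ 2 := by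
  have h : LinearMap.det (((ContinuousLinearMap.toSpanSingleton ℂ a : ℂ →L[ℂ] ℂ) :
      ℂ →ₗ[ℂ] ℂ)) = a := by simp
  have h2 : ((ContinuousLinearMap.toSpanSingleton ℂ a).restrictScalars ℝ).det =
      LinearMap.det ((((ContinuousLinearMap.toSpanSingleton ℂ a : ℂ →L[ℂ] ℂ) :
      ℂ →ₗ[ℂ] ℂ)).restrictScalars ℝ) := rfl
  rw [h2, LinearMap.det_restrictScalars, h, Algebra.norm_complex_apply, Complex.normSq_eq_norm_sq]

theorem exists_nhds_injOn {f : ℂ → ℂ} (hf : Differentiable ℂ f) {z : ℂ} (hz : deriv f z ≠ 0) :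
    ∃ U ∈ nhds z, IsOpen U ∧ Set.InjOn f U := by
  have hs : HasStrictDerivAt f (deriv f z) z :=
    (hf.analyticAt z).hasStrictDerivAt
  let e := (hs.hasStrictFDerivAt_equiv hz).toOpenPartialHomeomorph f
  exact ⟨e.source, e.open_source.mem_nhds
    (hs.hasStrictFDerivAt_equiv hz).mem_toOpenPartialHomeomorph_source, e.open_source, e.injOn⟩

/-- The set where an entire function is a local diffeomorphism splits into countably many Borel
pieces on which it is injective. -/
theorem exists_disjoint_cover_injOn {f : ℂ → ℂ} (hf : Differentiable ℂ f) :
    ∃ B : ℕ → Set ℂ, (∀ n, MeasurableSet (B n)) ∧ Pairwise (Function.onFun Disjoint B) ∧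
      (∀ n, Set.InjOn f (B n)) ∧ ⋃ n, B n = {z | deriv f z ≠ 0} := by
  have hcont : Continuous (deriv f) := (hf.contDiff (n := 1)).continuous_deriv le_rfl
  have hopen : IsOpen {z | deriv f z ≠ 0} := isOpen_ne_fun hcont continuous_const
  choose! U hU hUo hUi using fun z (hz : z ∈ {z | deriv f z ≠ 0}) => exists_nhds_injOn hf hz
  obtain ⟨t, hts, htc, hcov⟩ := TopologicalSpace.countable_cover_nhdsWithin
    (fun z hz => mem_nhdsWithin_of_mem_nhds (hU z hz))
  rcases t.eq_empty_or_nonempty with rfl | hne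
  · refine ⟨fun _ => ∅, fun _ => MeasurableSet.empty, fun _ _ _ => by simp [Function.onFun],
      fun _ => by simp, ?_⟩
    simp only [Set.mem_empty_iff_false, Set.iUnion_of_empty, Set.iUnion_empty,
      Set.subset_empty_iff] at hcov
    rw [hcov]; simp
  · obtain ⟨g, rfl⟩ := htc.exists_eq_range hne
    have hg : ∀ n, g n ∈ {z | deriv f z ≠ 0} := fun n => hts ⟨n, rfl⟩
    let V : ℕ → Set ℂ := fun n => U (g n) ∩ {z | deriv f z ≠ 0}
    have hV : ∀ n, MeasurableSet (V n) := fun n =>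
      ((hUo _ (hg n)).inter hopen).measurableSet
    refine ⟨disjointed V, fun n => MeasurableSet.disjointed hV n, disjoint_disjointed V,
      fun n => (hUi _ (hg n)).mono ((disjointed_subset V n).trans Set.inter_subset_left), ?_⟩
    rw [iUnion_disjointed]
    apply Set.Subset.antisymm
    · exact Set.iUnion_subset fun n => Set.inter_subset_right
    · intro z hz
      have := hcov hz
      simp only [Set.mem_range, Set.iUnion_exists, Set.iUnion_iUnion_eq', Set.mem_iUnion] at this
      obtain ⟨n, hn⟩ := this
      exact Set.mem_iUnion.2 ⟨n, hn, hz⟩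

/-- Sard's theorem: the critical values of an entire function form a null set. -/
theorem volume_image_critical {f : ℂ → ℂ} (hf : Differentiable ℂ f) :
    volume (f '' {z | deriv f z = 0}) = 0 :=
  addHaar_image_eq_zero_of_det_fderivWithin_eq_zero volume
    (fun z _ => (hasFDerivAt_restrictScalars hf z).hasFDerivWithinAt)
    (fun z hz => by
      rw [det_restrictScalars_toSpanSingleton]
      simp only [Set.mem_ofPred_eq] at hz
      simp [hz])

/-- Counting the preimages of `v` in a disjoint union of sets on which `f` is injective: each
piece contributes one point when `v` lies in its image, and none otherwise. -/
theorem encard_fiber_eq_tsum {f : ℂ → ℂ} {B : ℕ → Set ℂ}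
    (hd : Pairwise (Function.onFun Disjoint B)) (hi : ∀ n, Set.InjOn f (B n)) (v : ℂ) :
    ((({w | f w = v} ∩ ⋃ n, B n).encard : ℕ∞) : ℝ≥0∞) =
      ∑' n, (f '' B n).indicator (fun _ => (1 : ℝ≥0∞)) v := by
  have hc : ∀ s : Set ℂ, ((s.encard : ℕ∞) : ℝ≥0∞) = @Measure.count ℂ ⊤ s :=
    fun s => (@Measure.count_apply ℂ ⊤ s trivial).symm
  rw [hc, Set.inter_iUnion, @measure_iUnion ℕ ℂ ⊤ _ _ _
    (fun i j hij => ((hd hij).mono Set.inter_subset_right Set.inter_subset_right))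
    (fun _ => trivial)]
  congr 1
  funext n
  rw [← hc]
  by_cases hv : v ∈ f '' B n
  · obtain ⟨w, hw, rfl⟩ := hv
    have : {w' | f w' = f w} ∩ B n = {w} := by
      ext w'
      constructor
      · rintro ⟨h1, h2⟩
        exact hi n h2 hw h1
      · rintro rfl
        exact ⟨rfl, hw⟩
    rw [this, Set.indicator_of_mem (Set.mem_image_of_mem f hw)]
    simp
  · have : {w' | f w' = v} ∩ B n = ∅ := by
      ext w'
      simp only [Set.mem_inter_iff, Set.mem_ofPred_eq, Set.mem_empty_iff_false, iff_false]
      rintro ⟨h1, h2⟩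
      exact hv ⟨w', h2, h1⟩
    rw [this, Set.indicator_of_notMem hv]
    simp

/-- **Area formula** for entire functions. Values taken at critical points form a null set (Sard),
and off the critical points the change of variables applies piece by piece. -/
theorem lintegral_encard_fiber {f : ℂ → ℂ} (hf : Differentiable ℂ f) {A : Set ℂ}
    (hA : MeasurableSet A) {p : ℂ → ℝ≥0∞} (hp : Measurable p) :
    ∫⁻ v, (count {w | f w = v} A) * p v =
      ∫⁻ w in A, ENNReal.ofReal (‖deriv f w‖ ^ 2) * p (f w) := by
  obtain ⟨B, hBm, hBd, hBi, hBU⟩ := exists_disjoint_cover_injOn hf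
  let C : ℕ → Set ℂ := fun n => A ∩ B n
  have hCm : ∀ n, MeasurableSet (C n) := fun n => hA.inter (hBm n)
  have hCd : Pairwise (Function.onFun Disjoint C) := fun i j hij =>
    (hBd hij).mono Set.inter_subset_right Set.inter_subset_right
  have hCi : ∀ n, Set.InjOn f (C n) := fun n => (hBi n).mono Set.inter_subset_right
  have hCU : ⋃ n, C n = A ∩ {z | deriv f z ≠ 0} := by rw [← hBU, Set.inter_iUnion]
  have himm : ∀ n, MeasurableSet (f '' C n) := fun n =>
    (hCm n).image_of_continuousOn_injOn hf.continuous.continuousOn (hCi n)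
  have hnull : ∀ᵐ v ∂(volume : Measure ℂ), v ∉ f '' {z | deriv f z = 0} :=
    measure_eq_zero_iff_ae_notMem.1 (volume_image_critical hf)
  have h1 : ∫⁻ v, (count {w | f w = v} A) * p v =
      ∫⁻ v, ∑' n, (f '' C n).indicator p v := by
    refine lintegral_congr_ae (hnull.mono fun v hv => ?_)
    have h2 : {w | f w = v} ∩ A = {w | f w = v} ∩ ⋃ n, C n := by
      rw [hCU]
      ext w
      simp only [Set.mem_inter_iff, Set.mem_ofPred_eq, and_congr_right_iff]
      intro hw
      refine ⟨fun h => ⟨h, fun h0 => hv ⟨w, h0, hw⟩⟩, fun h => h.1⟩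
    simp only [count]
    rw [h2, encard_fiber_eq_tsum hCd hCi, ← ENNReal.tsum_mul_right]
    congr 1
    funext n
    by_cases h : v ∈ f '' C n
    · simp [Set.indicator_of_mem h]
    · simp [Set.indicator_of_notMem h]
  have h3 : ∀ n, ∫⁻ v, (f '' C n).indicator p v =
      ∫⁻ w in C n, ENNReal.ofReal (‖deriv f w‖ ^ 2) * p (f w) := fun n => by
    rw [lintegral_indicator (himm n), lintegral_image_eq_lintegral_abs_det_fderiv_mul volume (hCm n)
      (fun z _ => (hasFDerivAt_restrictScalars hf z).hasFDerivWithinAt) (hCi n) p]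
    simp only [det_restrictScalars_toSpanSingleton, abs_pow, abs_norm]
  rw [h1, lintegral_tsum (fun n => (hp.indicator (himm n)).aemeasurable)]
  simp only [h3]
  rw [← lintegral_iUnion hCm hCd, hCU, Set.inter_comm, ← setLIntegral_indicator]
  · refine lintegral_congr fun w => ?_
    by_cases h : deriv f w = 0
    · simp [Set.indicator, h]
    · simp [Set.indicator, h]
  · rw [← hBU]
    exact MeasurableSet.iUnion hBm

/-! ### Measurability of the number of zeros -/

/-- Whether a random continuous function vanishes somewhere on a compact space can be decided
on a countable dense set: it does iff it takes arbitrarily small values there. -/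
theorem measurableSet_exists_eq_zero {α Y : Type*} [MeasurableSpace α] [TopologicalSpace Y]
    [CompactSpace Y] [TopologicalSpace.SeparableSpace Y] {G : α → Y → ℝ}
    (hm : ∀ y, Measurable fun a => G a y) (hc : ∀ a, Continuous (G a)) :
    MeasurableSet {a | ∃ y, G a y = 0} := by
  obtain ⟨D, hDc, hDd⟩ := TopologicalSpace.exists_countable_dense Y
  have h : {a | ∃ y, G a y = 0} = ⋂ n : ℕ, ⋃ y ∈ D, {a | |G a y| < 1 / ((n : ℝ) + 1)} := by
    ext a
    simp only [Set.mem_ofPred_eq, Set.mem_iInter, Set.mem_iUnion, exists_prop]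
    constructor
    · rintro ⟨y, hy⟩ n
      have ho : IsOpen {y | |G a y| < 1 / ((n : ℝ) + 1)} :=
        isOpen_lt (hc a).abs continuous_const
      obtain ⟨y', hy', hyD⟩ := hDd.exists_mem_open ho
        ⟨y, by simp only [Set.mem_ofPred_eq, hy, abs_zero]; positivity⟩
      exact ⟨y', hy', hyD⟩
    · intro hn
      obtain ⟨y₀, -, -⟩ := hn 0
      obtain ⟨y, -, hy⟩ := isCompact_univ.exists_isMinOn ⟨y₀, Set.mem_univ y₀⟩
        (hc a).abs.continuousOn
      refine ⟨y, abs_eq_zero.1 (le_antisymm ?_ (abs_nonneg _))⟩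
      refine le_of_forall_pos_lt_add fun ε hε => ?_
      obtain ⟨n, hn'⟩ := exists_nat_one_div_lt hε
      obtain ⟨y', -, hy'⟩ := hn n
      rw [zero_add]
      exact ((hy (Set.mem_univ y')).trans_lt hy').trans hn'
  rw [h]
  exact MeasurableSet.iInter fun n => MeasurableSet.biUnion hDc fun y _ =>
    measurableSet_lt (hm y).abs measurable_const

/-- The `k`-tuples of points of `K` whose mutual distances are at least `δ`. -/
def separatedTuples (K : Set ℂ) (k : ℕ) (δ : ℝ) : Set (Fin k → ℂ) :=
  {y | (∀ i, y i ∈ K) ∧ ∀ i j, i ≠ j → δ ≤ dist (y i) (y j)}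

theorem isCompact_separatedTuples {K : Set ℂ} (hK : IsCompact K) (k : ℕ) (δ : ℝ) :
    IsCompact (separatedTuples K k δ) := by
  have h : separatedTuples K k δ = (Set.univ.pi fun _ => K) ∩
      ⋂ i, ⋂ j, ⋂ (_ : i ≠ j), {y : Fin k → ℂ | δ ≤ dist (y i) (y j)} := by
    ext y
    simp [separatedTuples]
  rw [h]
  refine (isCompact_univ_pi fun _ => hK).inter_right ?_
  refine isClosed_iInter fun i => isClosed_iInter fun j => isClosed_iInter fun _ => ?_
  exact isClosed_le continuous_const ((continuous_apply i).dist (continuous_apply j))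

theorem le_encard_iff_exists_separatedTuples (Z K : Set ℂ) (k : ℕ) :
    (k : ℕ∞) ≤ (Z ∩ K).encard ↔
      ∃ m : ℕ, ∃ y ∈ separatedTuples K k (1 / ((m : ℝ) + 1)), ∀ i, y i ∈ Z := by
  constructor
  · intro h
    obtain ⟨t, ht, htk⟩ := Set.exists_subset_encard_eq h
    have htf : t.Finite := Set.finite_of_encard_eq_coe htk
    obtain ⟨s, rfl⟩ := htf.exists_finset_coe
    have hs : s.card = k := by
      rw [Set.encard_coe_eq_coe_finsetCard] at htk
      exact_mod_cast htk
    let e := s.equivFinOfCardEq hs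
    let y : Fin k → ℂ := fun i => (e.symm i : ℂ)
    have hinj : Function.Injective y := Subtype.val_injective.comp e.symm.injective
    have hmem : ∀ i, y i ∈ Z ∩ K := fun i => ht (e.symm i).2
    have hex : ∃ m : ℕ, ∀ i j, i ≠ j → 1 / ((m : ℝ) + 1) ≤ dist (y i) (y j) := by
      have h1 : ∀ p : Fin k × Fin k, ∃ m : ℕ, p.1 ≠ p.2 →
          1 / ((m : ℝ) + 1) ≤ dist (y p.1) (y p.2) := fun p => by
        by_cases hp : p.1 = p.2
        · exact ⟨0, fun h => absurd hp h⟩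
        · obtain ⟨m, hm⟩ := exists_nat_one_div_lt (dist_pos.2 (hinj.ne hp))
          exact ⟨m, fun _ => hm.le⟩
      choose m hm using h1
      refine ⟨Finset.univ.sup m, fun i j hij => le_trans ?_ (hm (i, j) hij)⟩
      have : m (i, j) ≤ Finset.univ.sup m := Finset.le_sup (Finset.mem_univ _)
      gcongr
    obtain ⟨m, hm⟩ := hex
    exact ⟨m, y, ⟨fun i => (hmem i).2, hm⟩, fun i => (hmem i).1⟩
  · rintro ⟨m, y, ⟨hK, hd⟩, hZ⟩
    have hinj : Function.Injective y := fun i j hij => by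
      by_contra hne
      have := hd i j hne
      rw [hij, dist_self] at this
      have : (0 : ℝ) < 1 / ((m : ℝ) + 1) := by positivity
      linarith
    have h1 : (Set.range y).encard = k := by
      rw [← Set.image_univ, hinj.encard_image, Set.encard_univ]
      simp
    rw [← h1]
    exact Set.encard_le_encard (by rintro _ ⟨i, rfl⟩; exact ⟨hZ i, hK i⟩)

theorem measurable_encard_zeros_compact {α : Type*} [MeasurableSpace α] {G : α → ℂ → ℂ}
    (hm : ∀ z, Measurable fun a => G a z) (hc : ∀ a, Continuous (G a)) {K : Set ℂ}
    (hK : IsCompact K) : Measurable fun a => ({z | G a z = 0} ∩ K).encard := by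
  have hle : ∀ k : ℕ, MeasurableSet {a | (k : ℕ∞) ≤ ({z | G a z = 0} ∩ K).encard} := fun k => by
    have : {a | (k : ℕ∞) ≤ ({z | G a z = 0} ∩ K).encard} = ⋃ m : ℕ,
        {a | ∃ y : separatedTuples K k (1 / ((m : ℝ) + 1)), ∑ i, ‖G a (y.1 i)‖ = 0} := by
      ext a
      simp only [Set.mem_ofPred_eq, le_encard_iff_exists_separatedTuples, Set.mem_iUnion,
        Subtype.exists, exists_prop]
      refine exists_congr fun m => exists_congr fun y => and_congr_right fun _ => ?_
      rw [Finset.sum_eq_zero_iff_of_nonneg fun _ _ => norm_nonneg _]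
      simp
    rw [this]
    refine MeasurableSet.iUnion fun m => ?_
    have : CompactSpace (separatedTuples K k (1 / ((m : ℝ) + 1))) :=
      isCompact_iff_compactSpace.1 (isCompact_separatedTuples hK k _)
    refine measurableSet_exists_eq_zero
      (G := fun a (y : separatedTuples K k (1 / ((m : ℝ) + 1))) => ∑ i, ‖G a (y.1 i)‖)
      (fun y => Finset.measurable_sum _ fun i _ => (hm _).norm) (fun a => ?_)
    exact continuous_finsetSum _ fun i _ =>
      ((hc a).comp ((continuous_apply i).comp continuous_subtype_val)).norm
  rw [ENat.measurable_iff]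
  intro n
  have : (fun a => ({z | G a z = 0} ∩ K).encard) ⁻¹' {(n : ℕ∞)} =
      {a | (n : ℕ∞) ≤ ({z | G a z = 0} ∩ K).encard} \
        {a | ((n + 1 : ℕ) : ℕ∞) ≤ ({z | G a z = 0} ∩ K).encard} := by
    ext a
    simp only [Set.mem_preimage, Set.mem_singleton_iff, Set.mem_sdiff, Set.mem_ofPred_eq,
      Nat.cast_add, Nat.cast_one, not_le]
    rw [ENat.lt_add_one_iff (ENat.natCast_ne_top n)]
    exact ⟨fun h => ⟨h.ge, h.le⟩, fun h => le_antisymm h.2 h.1⟩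
  rw [this]
  exact (hle n).diff (hle (n + 1))

theorem finite_zeros_inter_compact {f : ℂ → ℂ} (hf : Differentiable ℂ f) (h0 : ∃ z, f z ≠ 0)
    {K : Set ℂ} (hK : IsCompact K) : ({z | f z = 0} ∩ K).Finite := by
  by_contra hinf
  obtain ⟨z, -, hz⟩ := Set.Infinite.exists_accPt_of_subset_isCompact hinf hK Set.inter_subset_right
  have hfr : ∃ᶠ w in nhdsWithin z {z}ᶜ, f w = 0 :=
    (accPt_iff_frequently_nhdsNE.1 hz).mono fun w hw => hw.1
  have han : AnalyticOnNhd ℂ f Set.univ := fun w _ => hf.analyticAt w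
  obtain ⟨w, hw⟩ := h0
  exact hw (han.eqOn_zero_of_preconnected_of_frequently_eq_zero isPreconnected_univ
    (Set.mem_univ z) hfr (Set.mem_univ w))

/-- The number of zeros of a random entire function in a Borel set is measurable. On compact sets
this is a statement about finitely many well-separated zeros; the passage to Borel sets is by the
π-λ theorem, applied to the counting measure of the zeros in a ball, which is finite unless the
function vanishes identically. -/
theorem measurable_count_zeros {α : Type*} [MeasurableSpace α] {G : α → ℂ → ℂ}
    (hm : ∀ z, Measurable fun a => G a z) (hd : ∀ a, Differentiable ℂ (G a)) {A : Set ℂ}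
    (hA : MeasurableSet A) (hb : Bornology.IsBounded A) :
    Measurable fun a => count {z | G a z = 0} A := by
  classical
  obtain ⟨R, hR⟩ := hb.subset_closedBall 0
  have hK : IsCompact (Metric.closedBall (0 : ℂ) R) := isCompact_closedBall 0 R
  obtain ⟨D, hDc, hDd⟩ := TopologicalSpace.exists_countable_dense ℂ
  let N : Set α := {a | ∀ z, G a z = 0}
  have hN : MeasurableSet N := by
    have : N = ⋂ z ∈ D, {a | G a z = 0} := by
      ext a
      simp only [N, Set.mem_ofPred_eq, Set.mem_iInter]
      refine ⟨fun h z _ => h z, fun h z => ?_⟩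
      exact congrFun ((hd a).continuous.ext_on hDd continuous_const fun z hz => h z hz) z
    rw [this]
    exact MeasurableSet.biInter hDc fun z _ => hm z (measurableSet_singleton 0)
  have hZc : ∀ a, IsClosed {z | G a z = 0} := fun a =>
    isClosed_eq (hd a).continuous continuous_const
  let κ : α → Measure ℂ := fun a => if a ∈ N then 0 else
    Measure.count.restrict ({z | G a z = 0} ∩ Metric.closedBall 0 R)
  have hκ : ∀ a ∉ N, ∀ s, MeasurableSet s →
      κ a s = count {z | G a z = 0} (s ∩ Metric.closedBall 0 R) := fun a ha s hs => by
    have e1 : s ∩ ({z | G a z = 0} ∩ Metric.closedBall 0 R) =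
        {z | G a z = 0} ∩ (s ∩ Metric.closedBall 0 R) := by
      ext z; simp only [Set.mem_inter_iff]; tauto
    simp only [κ, if_neg ha, count]
    rw [Measure.restrict_apply hs, e1, Measure.count_apply]
    exact (hZc a).measurableSet.inter (hs.inter hK.measurableSet)
  have hfin : ∀ a, IsFiniteMeasure (κ a) := fun a => by
    by_cases ha : a ∈ N
    · simp only [κ, if_pos ha]; infer_instance
    · refine ⟨?_⟩
      rw [hκ a ha _ MeasurableSet.univ, Set.univ_inter, count]
      have h0 : ∃ z, G a z ≠ 0 := by
        by_contra! h
        exact ha h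
      simpa using (finite_zeros_inter_compact (hd a) h0 hK)
  have hcl : ∀ s, IsClosed s → Measurable fun a => κ a s := fun s hs => by
    have : (fun a => κ a s) = fun a => if a ∈ N then 0 else
        (({z | G a z = 0} ∩ (s ∩ Metric.closedBall 0 R)).encard : ℝ≥0∞) := by
      funext a
      by_cases ha : a ∈ N
      · simp [κ, ha]
      · rw [hκ a ha s hs.measurableSet, if_neg ha, count]
    rw [this]
    refine Measurable.ite hN measurable_const ?_
    exact (measurable_of_countable (fun n : ℕ∞ => (n : ℝ≥0∞))).comp
      (measurable_encard_zeros_compact hm (fun a => (hd a).continuous) (hK.inter_left hs))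
  have hκm : Measurable κ := Measurable.measure_of_isPiSystem
    ((BorelSpace.measurable_eq (α := ℂ)).trans borel_eq_generateFrom_isClosed) isPiSystem_isClosed
    hcl (hcl _ isClosed_univ)
  have : (fun a => count {z | G a z = 0} A) = fun a =>
      if a ∈ N then ((A.encard : ℕ∞) : ℝ≥0∞) else κ a A := by
    funext a
    by_cases ha : a ∈ N
    · have : {z | G a z = 0} = Set.univ := Set.eq_univ_of_forall ha
      rw [if_pos ha, this, count, Set.univ_inter]
    · rw [if_neg ha, hκ a ha A hA, Set.inter_eq_left.2 hR]
  rw [this]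
  exact Measurable.ite hN measurable_const ((Measure.measurable_coe hA).comp hκm)

/-! ### Gaussian integrals on the complex plane -/

theorem integral_exp_neg_mul_norm_sq {b : ℝ} (hb : 0 < b) :
    ∫ z : ℂ, Real.exp (-b * ‖z‖ ^ 2) = Real.pi / b := by
  have h := Complex.integral_rpow_mul_exp_neg_mul_rpow (p := 2) (q := 0) (by norm_num)
    (by norm_num) hb
  simp only [Real.rpow_zero, one_mul, Real.rpow_two] at h
  rw [h]
  norm_num [Real.rpow_neg_one]
  ring

theorem integral_norm_sq_mul_exp_neg_mul_norm_sq {b : ℝ} (hb : 0 < b) :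
    ∫ z : ℂ, ‖z‖ ^ 2 * Real.exp (-b * ‖z‖ ^ 2) = Real.pi / b ^ 2 := by
  have h := Complex.integral_rpow_mul_exp_neg_mul_rpow (p := 2) (q := 2) (by norm_num)
    (by norm_num) hb
  simp only [Real.rpow_two] at h
  rw [h]
  norm_num
  rfl

theorem integrable_exp_neg_mul_norm_sq {b : ℝ} (hb : 0 < b) :
    Integrable fun z : ℂ => Real.exp (-b * ‖z‖ ^ 2) := by
  by_contra h
  have := integral_exp_neg_mul_norm_sq hb
  rw [integral_undef h] at this
  exact absurd this.symm (by positivity)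

theorem integrable_norm_sq_mul_exp_neg_mul_norm_sq {b : ℝ} (hb : 0 < b) :
    Integrable fun z : ℂ => ‖z‖ ^ 2 * Real.exp (-b * ‖z‖ ^ 2) := by
  by_contra h
  have := integral_norm_sq_mul_exp_neg_mul_norm_sq hb
  rw [integral_undef h] at this
  exact absurd this.symm (by positivity)

theorem norm_add_mul_sq (c a z : ℂ) :
    ‖c + a * z‖ ^ 2 = ‖c‖ ^ 2 + ‖a‖ ^ 2 * ‖z‖ ^ 2 + 2 * (star c * a * z).re := by
  rw [← Complex.normSq_eq_norm_sq, ← Complex.normSq_eq_norm_sq, ← Complex.normSq_eq_norm_sq,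
    ← Complex.normSq_eq_norm_sq]
  simp [Complex.normSq_apply]
  ring

theorem integral_re_mul_exp_neg_mul_norm_sq (b : ℝ) (c : ℂ) :
    ∫ z : ℂ, (c * z).re * Real.exp (-b * ‖z‖ ^ 2) = 0 := by
  have h := integral_neg_eq_self (fun z : ℂ => (c * z).re * Real.exp (-b * ‖z‖ ^ 2)) volume
  simp only [mul_neg, Complex.neg_re, norm_neg, neg_mul, integral_neg] at h
  simp only [neg_mul]
  linarith

theorem integrable_re_mul_exp_neg_mul_norm_sq {b : ℝ} (hb : 0 < b) (c : ℂ) :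
    Integrable fun z : ℂ => (c * z).re * Real.exp (-b * ‖z‖ ^ 2) := by
  have h := ((integrable_exp_neg_mul_norm_sq hb).add
    (integrable_norm_sq_mul_exp_neg_mul_norm_sq hb)).const_mul ‖c‖
  refine h.mono' (by fun_prop) (Filter.Eventually.of_forall fun z => ?_)
  have h1 : |(c * z).re| ≤ ‖c‖ * ‖z‖ := (Complex.abs_re_le_norm _).trans (norm_mul_le _ _)
  have h2 : ‖z‖ ≤ 1 + ‖z‖ ^ 2 := by nlinarith [sq_nonneg (‖z‖ - 1), norm_nonneg z]
  rw [norm_mul, Real.norm_eq_abs, Real.norm_eq_abs, abs_of_pos (Real.exp_pos _)]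
  simp only [Pi.add_apply]
  calc |(c * z).re| * Real.exp (-b * ‖z‖ ^ 2)
      ≤ (‖c‖ * (1 + ‖z‖ ^ 2)) * Real.exp (-b * ‖z‖ ^ 2) := by
        gcongr
        exact h1.trans (by gcongr)
    _ = _ := by ring

theorem norm_add_mul_sq_mul_exp (b : ℝ) (c a z : ℂ) :
    ‖c + a * z‖ ^ 2 * Real.exp (-b * ‖z‖ ^ 2) = ‖c‖ ^ 2 * Real.exp (-b * ‖z‖ ^ 2) +
      ‖a‖ ^ 2 * (‖z‖ ^ 2 * Real.exp (-b * ‖z‖ ^ 2)) +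
      2 * ((star c * a * z).re * Real.exp (-b * ‖z‖ ^ 2)) := by
  rw [norm_add_mul_sq]; ring

theorem integrable_norm_add_mul_sq_mul_exp {b : ℝ} (hb : 0 < b) (c a : ℂ) :
    Integrable fun z : ℂ => ‖c + a * z‖ ^ 2 * Real.exp (-b * ‖z‖ ^ 2) := by
  simp only [norm_add_mul_sq_mul_exp]
  exact (((integrable_exp_neg_mul_norm_sq hb).const_mul _).add
    ((integrable_norm_sq_mul_exp_neg_mul_norm_sq hb).const_mul _)).add
    ((integrable_re_mul_exp_neg_mul_norm_sq hb _).const_mul _)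

theorem integral_norm_add_mul_sq_mul_exp {b : ℝ} (hb : 0 < b) (c a : ℂ) :
    ∫ z : ℂ, ‖c + a * z‖ ^ 2 * Real.exp (-b * ‖z‖ ^ 2) =
      ‖c‖ ^ 2 * (Real.pi / b) + ‖a‖ ^ 2 * (Real.pi / b ^ 2) := by
  simp only [norm_add_mul_sq_mul_exp]
  have i1 := (integrable_exp_neg_mul_norm_sq hb).const_mul (‖c‖ ^ 2)
  have i2 := (integrable_norm_sq_mul_exp_neg_mul_norm_sq hb).const_mul (‖a‖ ^ 2)
  have i3 := (integrable_re_mul_exp_neg_mul_norm_sq hb (star c * a)).const_mul 2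
  rw [integral_add (by exact i1.add i2) i3, integral_add i1 i2]
  simp only [integral_const_mul]
  rw [integral_exp_neg_mul_norm_sq hb, integral_norm_sq_mul_exp_neg_mul_norm_sq hb,
    integral_re_mul_exp_neg_mul_norm_sq]
  ring

/-- Density of the centred circularly symmetric complex Gaussian law of variance `v`. -/
noncomputable def cgaussPDF (v : ℝ) (z : ℂ) : ℝ := Real.exp (-(1 / v) * ‖z‖ ^ 2) / (Real.pi * v)

/-- The centred circularly symmetric complex Gaussian law with `𝔼|Z|² = v`, for `v > 0`. -/
noncomputable def cgauss (v : ℝ) : Measure ℂ :=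
  volume.withDensity fun z => ENNReal.ofReal (cgaussPDF v z)

theorem continuous_cgaussPDF (v : ℝ) : Continuous (cgaussPDF v) := by
  unfold cgaussPDF; fun_prop

theorem cgaussPDF_nonneg {v : ℝ} (hv : 0 < v) (z : ℂ) : 0 ≤ cgaussPDF v z := by
  unfold cgaussPDF; positivity

theorem measurable_ofReal_cgaussPDF (v : ℝ) :
    Measurable fun z => ENNReal.ofReal (cgaussPDF v z) :=
  (continuous_cgaussPDF v).measurable.ennreal_ofReal

theorem isFiniteMeasure_cgauss {v : ℝ} (hv : 0 < v) : IsFiniteMeasure (cgauss v) :=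
  isFiniteMeasure_withDensity_ofReal
    (((integrable_exp_neg_mul_norm_sq (one_div_pos.2 hv)).div_const _).2)

theorem charFun_cgauss {v : ℝ} (hv : 0 < v) (w : ℂ) :
    charFun (cgauss v) w = ((Real.exp (-(v * ‖w‖ ^ 2) / 4) : ℝ) : ℂ) := by
  have h := GaussianFourier.integral_cexp_neg_mul_sq_norm_add (V := ℂ) (b := ((1 / v : ℝ) : ℂ))
    (by simpa using hv) Complex.I w
  rw [charFun_apply, cgauss, integral_withDensity_eq_integral_toReal_smul
    (measurable_ofReal_cgaussPDF v) (Filter.Eventually.of_forall fun _ => ENNReal.ofReal_lt_top)]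
  have e : ∀ z : ℂ, (ENNReal.ofReal (cgaussPDF v z)).toReal •
      Complex.exp ((inner ℝ z w : ℝ) * Complex.I) =
      Complex.exp (-((1 / v : ℝ) : ℂ) * ‖z‖ ^ 2 + Complex.I * (inner ℝ w z : ℝ)) *
        ((1 / (Real.pi * v) : ℝ) : ℂ) := fun z => by
    rw [ENNReal.toReal_ofReal (cgaussPDF_nonneg hv z), cgaussPDF, Complex.real_smul,
      Complex.exp_add, real_inner_comm, mul_comm Complex.I]
    push_cast
    ring
  simp only [e]
  rw [integral_mul_const, h]
  have hfr : (Module.finrank ℝ ℂ : ℂ) / 2 = 1 := by simp [Complex.finrank_real_complex]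
  rw [hfr, Complex.cpow_one]
  have hv' : (v : ℂ) ≠ 0 := by exact_mod_cast hv.ne'
  have hpi : (Real.pi : ℂ) ≠ 0 := by exact_mod_cast Real.pi_ne_zero
  have hexp : Complex.I ^ 2 * (‖w‖ : ℂ) ^ 2 / (4 * ((1 / v : ℝ) : ℂ)) =
      ((-(v * ‖w‖ ^ 2) / 4 : ℝ) : ℂ) := by
    push_cast
    rw [Complex.I_sq]
    field_simp
  rw [hexp, ← Complex.ofReal_exp]
  push_cast
  field_simp

theorem lintegral_cgauss {v : ℝ} (hv : 0 < v) {h : ℂ → ℝ} (hm : Measurable h)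
    (hh : ∀ z, 0 ≤ h z) (hi : Integrable fun z => cgaussPDF v z * h z) :
    ∫⁻ z, ENNReal.ofReal (h z) ∂(cgauss v) = ENNReal.ofReal (∫ z, cgaussPDF v z * h z) := by
  rw [cgauss, lintegral_withDensity_eq_lintegral_mul _ (measurable_ofReal_cgaussPDF v)
    hm.ennreal_ofReal, ofReal_integral_eq_lintegral_ofReal hi
      (Filter.Eventually.of_forall fun z => mul_nonneg (cgaussPDF_nonneg hv z) (hh z))]
  refine lintegral_congr fun z => ?_
  rw [Pi.mul_apply, ENNReal.ofReal_mul (cgaussPDF_nonneg hv z)]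

theorem lintegral_cgauss_norm_add_sq {v : ℝ} (hv : 0 < v) (c : ℂ) :
    ∫⁻ z, ENNReal.ofReal (‖c + z‖ ^ 2) ∂(cgauss v) = ENNReal.ofReal (‖c‖ ^ 2 + v) := by
  have hb : 0 < 1 / v := one_div_pos.2 hv
  have e : ∀ z : ℂ, cgaussPDF v z * ‖c + z‖ ^ 2 =
      ‖c + 1 * z‖ ^ 2 * Real.exp (-(1 / v) * ‖z‖ ^ 2) * (1 / (Real.pi * v)) := fun z => by
    rw [cgaussPDF, one_mul]; ring
  rw [lintegral_cgauss hv (by fun_prop) (fun _ => sq_nonneg _)]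
  · simp only [e]
    rw [integral_mul_const, integral_norm_add_mul_sq_mul_exp hb]
    congr 1
    have := Real.pi_ne_zero
    rw [norm_one]
    field_simp
  · simp only [e]
    exact (integrable_norm_add_mul_sq_mul_exp hb c 1).mul_const _

/-- Completing the square in the exponent `|a + z|² + |z|² / v`. -/
theorem norm_add_sq_add_norm_sq_div {v : ℝ} (hv : 0 < v) (a u : ℂ) :
    ‖a + (u - a * (v / (1 + v) : ℝ))‖ ^ 2 + 1 / v * ‖u - a * (v / (1 + v) : ℝ)‖ ^ 2 =
      ‖a‖ ^ 2 / (1 + v) + (1 + v) / v * ‖u‖ ^ 2 := by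
  have h1 : (1 + v) ≠ 0 := by positivity
  simp only [← Complex.normSq_eq_norm_sq, Complex.normSq_apply, Complex.add_re, Complex.sub_re,
    Complex.mul_re, Complex.ofReal_re, Complex.ofReal_im, Complex.add_im, Complex.sub_im,
    Complex.mul_im]
  field_simp
  ring

/-- The Gaussian expectation of `e^{-|a+Z|²} (|b + αZ|² + t)`: under the weight `e^{-|a+Z|²}`
the law of `Z` becomes, up to the mass `e^{-|a|²/(1+v)}/(1+v)`, Gaussian with mean
`-av/(1+v)` and variance `v/(1+v)`. -/
theorem lintegral_cgauss_tilted {v t : ℝ} (hv : 0 < v) (ht : 0 ≤ t) (a b α : ℂ) :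
    ∫⁻ z, ENNReal.ofReal (Real.exp (-‖a + z‖ ^ 2) * (‖b + α * z‖ ^ 2 + t)) ∂(cgauss v) =
      ENNReal.ofReal (Real.exp (-(‖a‖ ^ 2 / (1 + v))) / (1 + v) *
        (‖b - α * a * (v / (1 + v) : ℝ)‖ ^ 2 + ‖α‖ ^ 2 * (v / (1 + v)) + t)) := by
  have hv1 : 0 < 1 + v := by positivity
  have hb : 0 < (1 + v) / v := by positivity
  set d : ℂ := a * (v / (1 + v) : ℝ) with hd
  set κ : ℝ := Real.exp (-(‖a‖ ^ 2 / (1 + v))) / (Real.pi * v) with hκ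
  let H : ℂ → ℝ := fun z =>
    cgaussPDF v z * (Real.exp (-‖a + z‖ ^ 2) * (‖b + α * z‖ ^ 2 + t))
  have e : ∀ u : ℂ, H (u - d) =
      κ * (‖(b - α * d) + α * u‖ ^ 2 * Real.exp (-((1 + v) / v) * ‖u‖ ^ 2)) +
        κ * t * Real.exp (-((1 + v) / v) * ‖u‖ ^ 2) := fun u => by
    have h1 := norm_add_sq_add_norm_sq_div hv a u
    rw [← hd] at h1
    have h2 : Real.exp (-(1 / v) * ‖u - d‖ ^ 2) * Real.exp (-‖a + (u - d)‖ ^ 2) =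
        Real.exp (-(‖a‖ ^ 2 / (1 + v))) * Real.exp (-((1 + v) / v) * ‖u‖ ^ 2) := by
      rw [← Real.exp_add, ← Real.exp_add]
      congr 1
      linarith
    have h3 : b + α * (u - d) = (b - α * d) + α * u := by ring
    simp only [H, cgaussPDF, h3]
    calc _ = (Real.exp (-(1 / v) * ‖u - d‖ ^ 2) * Real.exp (-‖a + (u - d)‖ ^ 2)) *
          (‖(b - α * d) + α * u‖ ^ 2 + t) / (Real.pi * v) := by ring
      _ = _ := by rw [h2, hκ]; ring
  have i1 := (integrable_norm_add_mul_sq_mul_exp hb (b - α * d) α).const_mul κ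
  have i2 := (integrable_exp_neg_mul_norm_sq hb).const_mul (κ * t)
  have hHi : Integrable H := by
    have : Integrable fun u => H (u - d) := by
      simp only [e]
      exact i1.add i2
    simpa using this.comp_add_right d
  rw [lintegral_cgauss hv (by fun_prop) (fun z => by positivity) hHi]
  congr 1
  have h5 : ∫ z, H z = ∫ u, H (u - d) := (integral_sub_right_eq_self H d).symm
  change ∫ z, H z = _
  rw [h5]
  simp only [e]
  rw [integral_add i1 i2, integral_const_mul, integral_const_mul,
    integral_norm_add_mul_sq_mul_exp hb, integral_exp_neg_mul_norm_sq hb, hκ]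
  have h6 : α * a * (v / (1 + v) : ℝ) = α * d := by rw [hd, mul_assoc]
  rw [h6]
  have := Real.pi_ne_zero
  field_simp

/-! ### Gaussianity and independence of the noise coefficients -/

/-- The sesquilinear `L²` product `∫ φ conj ψ` of Schwartz functions. -/
noncomputable def l2Inner (φ ψ : 𝓢(ℝ, ℂ)) : ℂ := ∫ t : ℝ, φ t * star (ψ t)

theorem integrable_mul_star (φ ψ : 𝓢(ℝ, ℂ)) :
    Integrable (fun t : ℝ => φ t * star (ψ t)) volume := by
  have h : Integrable (fun t : ℝ => φ t) volume := φ.integrable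
  obtain ⟨C, hC⟩ := ψ.decay 0 0
  refine h.mul_bdd (c := C) (by fun_prop)
    (Filter.Eventually.of_forall fun t => ?_)
  have := hC.2 t
  simpa using this

theorem integrable_norm_sq (φ : 𝓢(ℝ, ℂ)) : Integrable (fun t : ℝ => ‖φ t‖ ^ 2) volume := by
  have h := (integrable_mul_star φ φ).norm
  simpa [sq] using h

theorem l2Inner_add_left (φ₁ φ₂ ψ : 𝓢(ℝ, ℂ)) :
    l2Inner (φ₁ + φ₂) ψ = l2Inner φ₁ ψ + l2Inner φ₂ ψ := by
  simp only [l2Inner, _root_.add_apply, add_mul]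
  exact integral_add (integrable_mul_star φ₁ ψ) (integrable_mul_star φ₂ ψ)

theorem l2Inner_smul_left (a : ℂ) (φ ψ : 𝓢(ℝ, ℂ)) :
    l2Inner (a • φ) ψ = a * l2Inner φ ψ := by
  simp only [l2Inner, _root_.smul_apply, smul_eq_mul, mul_assoc]
  exact integral_const_mul _ _

theorem star_l2Inner (φ ψ : 𝓢(ℝ, ℂ)) : star (l2Inner φ ψ) = l2Inner ψ φ := by
  simp only [l2Inner, RCLike.star_def]
  rw [← integral_conj]
  simp [mul_comm]

theorem l2Inner_smul_right (a : ℂ) (φ ψ : 𝓢(ℝ, ℂ)) :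
    l2Inner φ (a • ψ) = star a * l2Inner φ ψ := by
  rw [← star_l2Inner, l2Inner_smul_left, star_mul', star_l2Inner]

theorem l2Inner_sub_left (φ₁ φ₂ ψ : 𝓢(ℝ, ℂ)) :
    l2Inner (φ₁ - φ₂) ψ = l2Inner φ₁ ψ - l2Inner φ₂ ψ := by
  simp only [l2Inner, _root_.sub_apply, sub_mul]
  exact integral_sub (integrable_mul_star φ₁ ψ) (integrable_mul_star φ₂ ψ)

theorem l2Inner_sub_right (φ ψ₁ ψ₂ : 𝓢(ℝ, ℂ)) :
    l2Inner φ (ψ₁ - ψ₂) = l2Inner φ ψ₁ - l2Inner φ ψ₂ := by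
  rw [← star_l2Inner, l2Inner_sub_left, star_sub, star_l2Inner, star_l2Inner]

theorem l2Inner_self (φ : 𝓢(ℝ, ℂ)) : l2Inner φ φ = ((∫ t : ℝ, ‖φ t‖ ^ 2 : ℝ) : ℂ) := by
  rw [l2Inner, ← integral_complex_ofReal]
  refine integral_congr_ae (Filter.Eventually.of_forall fun t => ?_)
  simp only [RCLike.star_def, Complex.mul_conj, Complex.normSq_eq_norm_sq]

theorem integral_norm_sq_eq_re (φ : 𝓢(ℝ, ℂ)) : ∫ t : ℝ, ‖φ t‖ ^ 2 = (l2Inner φ φ).re := by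
  rw [l2Inner_self, Complex.ofReal_re]

/-- The Schwartz functions orthogonal to `ψ`. -/
noncomputable def l2Orthogonal (ψ : 𝓢(ℝ, ℂ)) : Submodule ℂ 𝓢(ℝ, ℂ) where
  carrier := {φ | l2Inner φ ψ = 0}
  add_mem' {a b} ha hb := by
    simp only [Set.mem_ofPred_eq] at *
    rw [l2Inner_add_left, ha, hb, add_zero]
  zero_mem' := by simp [l2Inner]
  smul_mem' c a ha := by
    simp only [Set.mem_ofPred_eq] at *
    rw [l2Inner_smul_left, ha, mul_zero]

theorem integral_norm_add_sq_of_orthogonal {φ ψ : 𝓢(ℝ, ℂ)} (h : l2Inner φ ψ = 0) :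
    ∫ t : ℝ, ‖(φ + ψ) t‖ ^ 2 = (∫ t : ℝ, ‖φ t‖ ^ 2) + ∫ t : ℝ, ‖ψ t‖ ^ 2 := by
  have h' : l2Inner ψ φ = 0 := by rw [← star_l2Inner, h, star_zero]
  have h1 : l2Inner (φ + ψ) (φ + ψ) = l2Inner φ φ + l2Inner ψ ψ := by
    have h2 : ∀ χ : 𝓢(ℝ, ℂ), l2Inner χ (φ + ψ) = l2Inner χ φ + l2Inner χ ψ := fun χ => by
      rw [← star_l2Inner, l2Inner_add_left, star_add, star_l2Inner, star_l2Inner]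
    rw [l2Inner_add_left, h2, h2, h, h', add_zero, zero_add]
  rw [integral_norm_sq_eq_re, h1, Complex.add_re, ← integral_norm_sq_eq_re,
    ← integral_norm_sq_eq_re]

theorem integral_norm_smul_sq (a : ℂ) (φ : 𝓢(ℝ, ℂ)) :
    ∫ t : ℝ, ‖(a • φ) t‖ ^ 2 = ‖a‖ ^ 2 * ∫ t : ℝ, ‖φ t‖ ^ 2 := by
  simp only [_root_.smul_apply, norm_smul, mul_pow]
  exact integral_const_mul _ _

/-- Every real-linear functional on `ℂ` has the form `z ↦ Re (a z)`. -/
theorem exists_re_mul_eq (ℓ : ℂ → ℝ) (ha : ∀ z w, ℓ (z + w) = ℓ z + ℓ w)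
    (hs : ∀ (r : ℝ) z, ℓ (r • z) = r * ℓ z) : ∃ a : ℂ, ∀ z, ℓ z = (a * z).re := by
  refine ⟨⟨ℓ 1, -ℓ Complex.I⟩, fun z => ?_⟩
  have : z = z.re • (1 : ℂ) + z.im • Complex.I := by
    simp [Complex.re_add_im]
  conv_lhs => rw [this]
  rw [ha, hs, hs, Complex.mul_re]
  ring

section

variable {Ω : Type*} [MeasurableSpace Ω] {μ : Measure Ω}
  {ξ : Ω → 𝓢'(ℝ, ℂ)}

theorem IsComplexWhiteNoise.charFun_map (hξ : IsComplexWhiteNoise μ ξ) (φ : 𝓢(ℝ, ℂ)) (w : ℂ) :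
    charFun (μ.map fun ω => ξ ω φ) w =
      ((Real.exp (-((∫ t : ℝ, ‖φ t‖ ^ 2) * ‖w‖ ^ 2) / 4) : ℝ) : ℂ) := by
  rw [MeasureTheory.charFun_apply, integral_map (hξ.measurable_apply φ).aemeasurable (by fun_prop)]
  have h := hξ.charFun_apply (star w • φ)
  rw [integral_norm_smul_sq, norm_star, mul_comm (‖w‖ ^ 2)] at h
  rw [← h]
  congr 1
  funext ω
  rw [map_smul, Complex.inner, mul_comm Complex.I]
  have e : (w * (starRingEnd ℂ) (ξ ω φ)).re = (star w • ξ ω φ).re := by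
    simp
  rw [e]

/-- A noise coefficient is circularly symmetric complex Gaussian. -/
theorem IsComplexWhiteNoise.map_eq_cgauss [IsProbabilityMeasure μ]
    (hξ : IsComplexWhiteNoise μ ξ) (φ : 𝓢(ℝ, ℂ)) {v : ℝ}
    (hv : ∫ t : ℝ, ‖φ t‖ ^ 2 = v) (hpos : 0 < v) : μ.map (fun ω => ξ ω φ) = cgauss v := by
  have := isFiniteMeasure_cgauss hpos
  refine Measure.ext_of_charFun ?_
  funext w
  rw [hξ.charFun_map, charFun_cgauss hpos, hv]

theorem eq_zero_of_integral_norm_sq_eq_zero {φ : 𝓢(ℝ, ℂ)} (h : ∫ t : ℝ, ‖φ t‖ ^ 2 = 0) :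
    φ = 0 := by
  rw [integral_eq_zero_iff_of_nonneg (fun _ => sq_nonneg _) (integrable_norm_sq φ)] at h
  have h2 : (fun t : ℝ => ‖φ t‖ ^ 2) = 0 :=
    Continuous.ae_eq_iff_eq volume (φ.continuous.norm.pow 2) continuous_const |>.1 h
  ext t
  have := congrFun h2 t
  simpa using this

theorem IsComplexWhiteNoise.lintegral_norm_add_sq [IsProbabilityMeasure μ]
    (hξ : IsComplexWhiteNoise μ ξ) (φ : 𝓢(ℝ, ℂ)) (c : ℂ) : ∫⁻ ω, ENNReal.ofReal (‖c + ξ ω φ‖ ^ 2) ∂μ =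
      ENNReal.ofReal (‖c‖ ^ 2 + ∫ t : ℝ, ‖φ t‖ ^ 2) := by
  have hnn : 0 ≤ ∫ t : ℝ, ‖φ t‖ ^ 2 := integral_nonneg fun _ => sq_nonneg _
  -- A coefficient of variance `0` has no density, but then `φ = 0`.
  rcases hnn.eq_or_lt with h0 | hpos
  · have := eq_zero_of_integral_norm_sq_eq_zero h0.symm
    simp [this]
  · rw [← lintegral_cgauss_norm_add_sq hpos, ← hξ.map_eq_cgauss φ rfl hpos,
      lintegral_map (by fun_prop) (hξ.measurable_apply φ)]

/-- Noise coefficients against test functions orthogonal to `ψ` are jointly independent of the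
noise coefficient against `ψ`. -/
theorem IsComplexWhiteNoise.indepFun_of_orthogonal [IsProbabilityMeasure μ]
    (hξ : IsComplexWhiteNoise μ ξ) {ι : Type*}
    (φ : ι → 𝓢(ℝ, ℂ)) (ψ : 𝓢(ℝ, ℂ)) (h : ∀ i, l2Inner (φ i) ψ = 0) :
    IndepFun (fun ω i => ξ ω (φ i)) (fun ω => ξ ω ψ) μ := by
  classical
  have hmψ := hξ.measurable_apply ψ
  refine IndepFun.process_indepFun (fun i => hξ.measurable_apply (φ i)) hmψ fun I => ?_
  have hmI : Measurable fun ω (i : I) => ξ ω (φ i) :=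
    measurable_pi_lambda _ fun i => hξ.measurable_apply (φ i)
  rw [indepFun_iff_charFunDual_prod hmI.aemeasurable hmψ.aemeasurable]
  intro L
  choose a ha using fun i : I => exists_re_mul_eq (fun z => L (Pi.single i z, 0))
    (fun z w => by rw [← map_add]; simp [Pi.single_add])
    (fun r z => by rw [← smul_eq_mul, ← map_smul, Prod.smul_mk, smul_zero, Pi.single_smul])
  obtain ⟨b, hb⟩ := exists_re_mul_eq (fun z => L (0, z))
    (fun z w => by rw [← map_add]; simp)
    (fun r z => by rw [← smul_eq_mul, ← map_smul]; simp)
  have hL1 : ∀ ω, L.comp (.inl ℝ (I → ℂ) ℂ) (fun i : I => ξ ω (φ i)) =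
      (ξ ω (∑ i, a i • φ i)).re := fun ω => by
    have e : (fun i : I => ξ ω (φ i)) = ∑ i : I, Pi.single i (ξ ω (φ i)) :=
      (Finset.univ_sum_single _).symm
    rw [e, map_sum, map_sum, Complex.re_sum]
    refine Finset.sum_congr rfl fun i _ => ?_
    rw [map_smul, smul_eq_mul, ← ha]
    rfl
  have hL2 : ∀ ω, L.comp (.inr ℝ (I → ℂ) ℂ) (ξ ω ψ) = (ξ ω (b • ψ)).re := fun ω => by
    rw [map_smul, smul_eq_mul, ← hb]
    rfl
  have hL : ∀ ω, L ((fun i : I => ξ ω (φ i)), ξ ω ψ) =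
      (ξ ω (∑ i, a i • φ i + b • ψ)).re := fun ω => by
    rw [map_add, Complex.add_re, ← hL1, ← hL2]
    exact (ContinuousLinearMap.comp_inl_add_comp_inr L _).symm
  have horth : l2Inner (∑ i, a i • φ i) (b • ψ) = 0 := by
    rw [l2Inner_smul_right]
    have : ∑ i, a i • φ i ∈ l2Orthogonal ψ :=
      Submodule.sum_mem _ fun i _ => Submodule.smul_mem _ _ (h i)
    have : l2Inner (∑ i, a i • φ i) ψ = 0 := this
    rw [this, mul_zero]
  rw [charFunDual_apply, charFunDual_apply, charFunDual_apply,
    integral_map (hmI.prodMk hmψ).aemeasurable (by fun_prop),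
    integral_map hmI.aemeasurable (by fun_prop), integral_map hmψ.aemeasurable (by fun_prop)]
  simp only [hL1, hL2, hL, mul_comm _ Complex.I]
  rw [hξ.charFun_apply, hξ.charFun_apply, hξ.charFun_apply,
    integral_norm_add_sq_of_orthogonal horth, ← Complex.ofReal_mul, ← Real.exp_add]
  congr 2
  ring

end

/-! ### Complex translates of the Gaussian as Schwartz functions -/

/-- The entire Gaussian `u ↦ e^{-π u²}`. -/
noncomputable def entireGauss (u : ℂ) : ℂ := Complex.exp (-(Real.pi : ℂ) * u ^ 2)

theorem differentiable_entireGauss : Differentiable ℂ entireGauss := by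
  unfold entireGauss; fun_prop

theorem contDiff_entireGauss : ContDiff ℂ ((⊤ : ℕ∞) : WithTop ℕ∞) entireGauss := by
  unfold entireGauss; fun_prop

theorem differentiable_iteratedDeriv {f : ℂ → ℂ} (hf : ContDiff ℂ ((⊤ : ℕ∞) : WithTop ℕ∞) f)
    (n : ℕ) : Differentiable ℂ (iteratedDeriv n f) :=
  hf.differentiable_iteratedDeriv n (by exact_mod_cast ENat.natCast_lt_top n)

theorem norm_entireGauss (u : ℂ) :
    ‖entireGauss u‖ = Real.exp (-Real.pi * ‖u‖ ^ 2 + 2 * Real.pi * u.im ^ 2) := by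
  rw [entireGauss, Complex.norm_exp, ← Complex.normSq_eq_norm_sq, Complex.normSq_apply]
  congr 1
  simp [sq]
  ring

theorem one_add_norm_pow_mul_entireGauss_le (m : ℕ) (R : ℝ) : ∃ C : ℝ, ∀ u : ℂ, |u.im| ≤ R →
    (1 + ‖u‖) ^ m * ‖entireGauss u‖ ≤ C := by
  refine ⟨(m.factorial : ℝ) * Real.exp (2 + 2 * Real.pi * R ^ 2), fun u hu => ?_⟩
  have h1 : (1 + ‖u‖) ^ m ≤ (m.factorial : ℝ) * Real.exp (1 + ‖u‖) := by
    have := Real.pow_div_factorial_le_exp (1 + ‖u‖) (by positivity) m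
    rwa [div_le_iff₀' (by positivity)] at this
  have h2 : u.im ^ 2 ≤ R ^ 2 := sq_le_sq' (by linarith [neg_abs_le u.im]) ((le_abs_self _).trans hu)
  have h3 : ‖u‖ - Real.pi * ‖u‖ ^ 2 ≤ 1 := by
    nlinarith [Real.pi_gt_three, sq_nonneg (‖u‖ - 1), sq_nonneg ‖u‖]
  rw [norm_entireGauss]
  calc _ ≤ (m.factorial : ℝ) * Real.exp (1 + ‖u‖) *
        Real.exp (-Real.pi * ‖u‖ ^ 2 + 2 * Real.pi * u.im ^ 2) := by gcongr
    _ = (m.factorial : ℝ) *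
        Real.exp (1 + ‖u‖ + (-Real.pi * ‖u‖ ^ 2 + 2 * Real.pi * u.im ^ 2)) := by
        rw [mul_assoc, ← Real.exp_add]
    _ ≤ _ := by
        refine mul_le_mul_of_nonneg_left (Real.exp_le_exp.2 ?_) (by positivity)
        nlinarith [Real.pi_pos]

/-- The derivatives of the Gaussian decay faster than any power on horizontal strips, by
Cauchy's estimate on unit circles. -/
theorem one_add_norm_pow_mul_iteratedDeriv_entireGauss_le (m n : ℕ) (R : ℝ) :
    ∃ C : ℝ, ∀ u : ℂ, |u.im| ≤ R → (1 + ‖u‖) ^ m * ‖iteratedDeriv n entireGauss u‖ ≤ C := by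
  obtain ⟨C, hC⟩ := one_add_norm_pow_mul_entireGauss_le m (R + 1)
  refine ⟨2 ^ m * (n.factorial * C), fun u hu => ?_⟩
  have hpos : 0 < (1 + ‖u‖) ^ m := by positivity
  have hb : ∀ z ∈ Metric.sphere u 1, ‖entireGauss z‖ ≤ 2 ^ m * C / (1 + ‖u‖) ^ m := by
    intro z hz
    have hz1 : ‖z - u‖ = 1 := by simpa [dist_eq_norm] using hz
    have him : |z.im| ≤ R + 1 := by
      have h1 : |(z - u).im| ≤ 1 := hz1 ▸ Complex.abs_im_le_norm _
      have h2 : z.im = u.im + (z - u).im := by simp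
      rw [h2]
      exact (abs_add_le _ _).trans (add_le_add hu h1)
    have hn : 1 + ‖u‖ ≤ 2 * (1 + ‖z‖) := by
      have : ‖u‖ ≤ ‖z‖ + ‖z - u‖ := by
        have := norm_sub_le z (z - u)
        simpa using this
      rw [hz1] at this
      linarith [norm_nonneg z]
    rw [le_div_iff₀ hpos]
    calc ‖entireGauss z‖ * (1 + ‖u‖) ^ m ≤ ‖entireGauss z‖ * (2 * (1 + ‖z‖)) ^ m := by gcongr
      _ = 2 ^ m * ((1 + ‖z‖) ^ m * ‖entireGauss z‖) := by rw [mul_pow]; ring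
      _ ≤ 2 ^ m * C := by gcongr; exact hC z him
  have h := Complex.norm_iteratedDeriv_le_of_forall_mem_sphere_norm_le n one_pos
    differentiable_entireGauss.diffContOnCl hb
  rw [one_pow, div_one] at h
  calc _ ≤ (1 + ‖u‖) ^ m * (n.factorial * (2 ^ m * C / (1 + ‖u‖) ^ m)) := by gcongr
    _ = _ := by field_simp

/-- A version uniform in the translation parameter. -/
theorem pow_mul_iteratedDeriv_entireGauss_sub_le (k n : ℕ) (R : ℝ) : ∃ C : ℝ, ∀ (t : ℝ) (w : ℂ),
    ‖w‖ ≤ R → |t| ^ k * ‖iteratedDeriv n entireGauss (t - w)‖ ≤ C := by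
  obtain ⟨C, hC⟩ := one_add_norm_pow_mul_iteratedDeriv_entireGauss_le k n R
  refine ⟨(1 + R) ^ k * C, fun t w hw => ?_⟩
  have hR : 0 ≤ R := (norm_nonneg w).trans hw
  have him : |((t : ℂ) - w).im| ≤ R := by
    simpa using (Complex.abs_im_le_norm w).trans hw
  have ht : |t| ≤ (1 + R) * (1 + ‖(t : ℂ) - w‖) := by
    have h1 : |t| ≤ ‖(t : ℂ) - w‖ + ‖w‖ := by
      have := norm_add_le ((t : ℂ) - w) w
      simpa using this
    nlinarith [norm_nonneg ((t : ℂ) - w)]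
  calc |t| ^ k * ‖iteratedDeriv n entireGauss (t - w)‖
      ≤ ((1 + R) * (1 + ‖(t : ℂ) - w‖)) ^ k * ‖iteratedDeriv n entireGauss (t - w)‖ := by gcongr
    _ = (1 + R) ^ k * ((1 + ‖(t : ℂ) - w‖) ^ k * ‖iteratedDeriv n entireGauss (t - w)‖) := by
        rw [mul_pow]; ring
    _ ≤ _ := by gcongr; exact hC _ him

theorem iteratedDeriv_comp_ofReal_sub {f : ℂ → ℂ} (hf : ContDiff ℂ ((⊤ : ℕ∞) : WithTop ℕ∞) f)
    (w : ℂ) (n : ℕ) : iteratedDeriv n (fun t : ℝ => f (t - w)) =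
      fun t : ℝ => iteratedDeriv n f (t - w) := by
  induction n with
  | zero => simp
  | succ n ih =>
    rw [iteratedDeriv_succ, ih]
    funext t
    have h1 := (differentiable_iteratedDeriv hf n ((t : ℂ) - w)).hasDerivAt
    have h2 : HasDerivAt (fun z : ℂ => iteratedDeriv n f (z - w))
        (deriv (iteratedDeriv n f) ((t : ℂ) - w)) (t : ℂ) := h1.comp_sub_const _ _
    rw [h2.comp_ofReal.deriv, iteratedDeriv_succ]

/-- The Schwartz function `t ↦ e^{-π (t - w)²}`, for complex `w`. -/
noncomputable def gaussShift (w : ℂ) : 𝓢(ℝ, ℂ) where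
  toFun t := entireGauss (t - w)
  smooth' := by
    unfold entireGauss
    have h1 : ContDiff ℝ ((⊤ : ℕ∞) : WithTop ℕ∞) (fun t : ℝ => (t : ℂ)) :=
      Complex.ofRealCLM.contDiff
    exact (contDiff_const.mul ((h1.sub contDiff_const).pow 2)).cexp
  decay' k n := by
    obtain ⟨C, hC⟩ := pow_mul_iteratedDeriv_entireGauss_sub_le k n ‖w‖
    refine ⟨C, fun t => ?_⟩
    rw [norm_iteratedFDeriv_eq_norm_iteratedDeriv,
      iteratedDeriv_comp_ofReal_sub contDiff_entireGauss]
    exact hC t w le_rfl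

theorem gaussShift_apply (w : ℂ) (t : ℝ) : gaussShift w t = entireGauss (t - w) := rfl

theorem iteratedDeriv_gaussShift (w : ℂ) (n : ℕ) :
    iteratedDeriv n (gaussShift w) = fun t : ℝ => iteratedDeriv n entireGauss (t - w) :=
  iteratedDeriv_comp_ofReal_sub contDiff_entireGauss w n

/-- Second-order Taylor estimate for an entire function. -/
theorem norm_sub_sub_deriv_mul_le {f : ℂ → ℂ} (hf : ContDiff ℂ ((⊤ : ℕ∞) : WithTop ℕ∞) f) {B : ℝ}
    (hB : ∀ s : ℂ, ‖s‖ ≤ 1 → ‖deriv (deriv f) s‖ ≤ B) {δ : ℂ} (hδ : ‖δ‖ ≤ 1) :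
    ‖f δ - f 0 - δ * deriv f 0‖ ≤ B * ‖δ‖ ^ 2 := by
  have hd0 : Differentiable ℂ f := by simpa using differentiable_iteratedDeriv hf 0
  have hd1 : Differentiable ℂ (deriv f) := by simpa using differentiable_iteratedDeriv hf 1
  have hB0 : 0 ≤ B := (norm_nonneg _).trans (hB 0 (by simp))
  have h1 : ∀ s : ℂ, ‖s‖ ≤ ‖δ‖ → ‖deriv f s - deriv f 0‖ ≤ B * ‖δ‖ := fun s hs => by
    have := (convex_closedBall (0 : ℂ) ‖δ‖).norm_image_sub_le_of_norm_deriv_le (f := deriv f)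
      (fun z _ => hd1 z) (fun z hz => hB z ((mem_closedBall_zero_iff.1 hz).trans hδ))
      (Metric.mem_closedBall_self (norm_nonneg _)) (mem_closedBall_zero_iff.2 hs)
    rw [sub_zero] at this
    exact this.trans (by gcongr)
  have hq : ∀ s, HasDerivAt (fun s => f s - f 0 - s * deriv f 0) (deriv f s - deriv f 0) s :=
    fun s => by
      have := ((hd0 s).hasDerivAt.sub_const (f 0)).sub ((hasDerivAt_id s).mul_const (deriv f 0))
      simpa using! this
  have := (convex_closedBall (0 : ℂ) ‖δ‖).norm_image_sub_le_of_norm_deriv_le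
      (f := fun s => f s - f 0 - s * deriv f 0) (C := B * ‖δ‖)
      (fun z _ => (hq z).differentiableAt)
      (fun z hz => by rw [(hq z).deriv]; exact h1 z (mem_closedBall_zero_iff.1 hz))
      (Metric.mem_closedBall_self (norm_nonneg _)) (mem_closedBall_zero_iff.2 (le_refl ‖δ‖))
  simp only [zero_mul, sub_zero, sub_self] at this
  calc _ ≤ _ := this
    _ = _ := by ring

/-- The difference quotients of `w ↦ gaussShift w` converge in every Schwartz seminorm: for fixed
`t`, the `n`-th derivative in `t` is an entire function of `w`, with second derivative bounded
by a constant times `|t|^{-k}`. -/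
theorem seminorm_gaussShift_slope_le (k n : ℕ) (w : ℂ) : ∃ C : ℝ, ∀ δ : ℂ, δ ≠ 0 → ‖δ‖ ≤ 1 →
    SchwartzMap.seminorm ℂ k n (δ⁻¹ • (gaussShift (w + δ) - gaussShift w) -
      (-SchwartzMap.derivCLM ℂ ℂ (gaussShift w))) ≤ C * ‖δ‖ := by
  obtain ⟨C, hC⟩ := pow_mul_iteratedDeriv_entireGauss_sub_le k (n + 2) (‖w‖ + 1)
  have hC0 : 0 ≤ C := le_trans (by positivity) (hC 0 w (by linarith))
  refine ⟨C, fun δ hδ hδ1 => SchwartzMap.seminorm_le_bound' ℂ k n _ (by positivity) fun t => ?_⟩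
  have hd : ⇑(SchwartzMap.derivCLM ℂ ℂ (gaussShift w)) = deriv (gaussShift w) := by
    funext t; exact SchwartzMap.derivCLM_apply ℂ _ t
  have hder : iteratedDeriv n (deriv (gaussShift w)) t =
      iteratedDeriv (n + 1) entireGauss (t - w) := by
    rw [← iteratedDeriv_succ', iteratedDeriv_gaussShift]
  let f : ℂ → ℂ := fun s => iteratedDeriv n entireGauss (t - w - s)
  have hfd : ∀ m : ℕ, ∀ s, HasDerivAt (fun s => iteratedDeriv m entireGauss (t - w - s))
      (-iteratedDeriv (m + 1) entireGauss (t - w - s)) s := fun m s => by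
    have h1 := (differentiable_iteratedDeriv contDiff_entireGauss m ((t : ℂ) - w - s)).hasDerivAt
    rw [← iteratedDeriv_succ] at h1
    exact h1.comp_const_sub _ _
  have hf1 : deriv f = fun s => -iteratedDeriv (n + 1) entireGauss (t - w - s) :=
    funext fun s => (hfd n s).deriv
  have hf2 : deriv (deriv f) = fun s => iteratedDeriv (n + 2) entireGauss (t - w - s) := by
    rw [hf1]
    funext s
    have := (hfd (n + 1) s).fun_neg.deriv
    rw [this, neg_neg]
  have hfc : ContDiff ℂ ((⊤ : ℕ∞) : WithTop ℕ∞) f :=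
    Differentiable.contDiff fun s => (hfd n s).differentiableAt
  have hval : iteratedDeriv n (⇑(δ⁻¹ • (gaussShift (w + δ) - gaussShift w) -
      (-SchwartzMap.derivCLM ℂ ℂ (gaussShift w)))) t =
      δ⁻¹ * (f δ - f 0 - δ * deriv f 0) := by
    have e : ⇑(δ⁻¹ • (gaussShift (w + δ) - gaussShift w) -
        (-SchwartzMap.derivCLM ℂ ℂ (gaussShift w))) =
        (fun t => δ⁻¹ • (gaussShift (w + δ) t - gaussShift w t)) + deriv (gaussShift w) := by
      rw [← hd]; funext t; simp
    have hs : ∀ (φ : 𝓢(ℝ, ℂ)) (m : ℕ), ContDiffAt ℝ m φ t := fun φ m => (φ.smooth m).contDiffAt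
    have hsd : ContDiffAt ℝ n (deriv (gaussShift w)) t := by rw [← hd]; exact hs _ n
    rw [e, iteratedDeriv_add ((((hs _ n).sub (hs _ n)).const_smul _)) hsd,
      iteratedDeriv_fun_const_smul_field,
      iteratedDeriv_fun_sub (hs _ n) (hs _ n), hder, iteratedDeriv_gaussShift,
      iteratedDeriv_gaussShift, hf1]
    simp only [f, sub_zero, smul_eq_mul, sub_sub (t : ℂ) w δ]
    rw [mul_sub δ⁻¹ (_ - _), inv_mul_cancel_left₀ hδ, sub_neg_eq_add]
  rw [hval, norm_mul, norm_inv]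
  have hpos : 0 < ‖δ‖ := norm_pos_iff.2 hδ
  rcases eq_or_ne (|t| ^ k) 0 with h0 | h0
  · rw [h0, zero_mul]; positivity
  have htk : 0 < |t| ^ k := lt_of_le_of_ne (by positivity) h0.symm
  have hT := norm_sub_sub_deriv_mul_le hfc (B := C / |t| ^ k) (fun s hs => by
    simp only [hf2]
    rw [le_div_iff₀' htk, sub_sub]
    exact hC t (w + s) ((norm_add_le _ _).trans (by gcongr))) hδ1
  calc |t| ^ k * (‖δ‖⁻¹ * ‖f δ - f 0 - δ * deriv f 0‖)
      ≤ |t| ^ k * (‖δ‖⁻¹ * (C / |t| ^ k * ‖δ‖ ^ 2)) := by gcongr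
    _ = C * ‖δ‖ := by field_simp

/-- The complex translates of the Gaussian depend holomorphically, in the Schwartz topology, on
the translation parameter; hence so does the pairing with a tempered distribution. -/
theorem hasDerivAt_apply_gaussShift (u : 𝓢'(ℝ, ℂ)) (w : ℂ) :
    HasDerivAt (fun w => u (gaussShift w)) (-u (SchwartzMap.derivCLM ℂ ℂ (gaussShift w))) w := by
  rw [hasDerivAt_iff_tendsto_slope_zero]
  have hlim : Filter.Tendsto (fun δ : ℂ => δ⁻¹ • (gaussShift (w + δ) - gaussShift w))
      (nhdsWithin 0 {0}ᶜ) (nhds (-SchwartzMap.derivCLM ℂ ℂ (gaussShift w))) := by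
    rw [(schwartz_withSeminorms ℂ ℝ ℂ).tendsto_nhds]
    rintro ⟨k, n⟩ ε hε
    obtain ⟨C, hC⟩ := seminorm_gaussShift_slope_le k n w
    have h1 : ∀ᶠ δ : ℂ in nhdsWithin 0 {0}ᶜ, C * ‖δ‖ < ε := by
      refine Filter.Eventually.filter_mono nhdsWithin_le_nhds ?_
      have : Filter.Tendsto (fun δ : ℂ => C * ‖δ‖) (nhds 0) (nhds 0) := by
        have h : Continuous fun δ : ℂ => C * ‖δ‖ := by fun_prop
        simpa using h.tendsto 0
      exact this.eventually (gt_mem_nhds hε)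
    have h2 : ∀ᶠ δ : ℂ in nhdsWithin 0 {0}ᶜ, ‖δ‖ ≤ 1 := by
      refine Filter.Eventually.filter_mono nhdsWithin_le_nhds ?_
      filter_upwards [Metric.closedBall_mem_nhds (0 : ℂ) one_pos] with δ hδ
      simpa using hδ
    filter_upwards [h1, h2, self_mem_nhdsWithin] with δ hδ1 hδ2 hδ0
    exact (hC δ hδ0 hδ2).trans_lt hδ1
  have hu : Continuous fun φ : 𝓢(ℝ, ℂ) => u φ := ContinuousLinearMap.continuous u
  have h3 := (hu.tendsto _).comp hlim
  rw [map_neg] at h3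
  refine h3.congr fun δ => ?_
  rw [Function.comp_apply, map_smul, map_sub]

/-! ### Fock normalisation of the shifted windows -/

/-- The shifted window in the normalisation that makes it holomorphic in `w`:
`t ↦ 2^{1/4} e^{-πt² + 2πtw - πw²/2}`. -/
noncomputable def fockAtom (w : ℂ) : 𝓢(ℝ, ℂ) :=
  (((2 : ℝ) ^ (1 / 4 : ℝ) : ℝ) * Complex.exp (Real.pi * w ^ 2 / 2) : ℂ) • gaussShift w

/-- The derivative of `fockAtom` with respect to `w`. -/
noncomputable def fockAtomDeriv (w : ℂ) : 𝓢(ℝ, ℂ) :=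
  (((2 : ℝ) ^ (1 / 4 : ℝ) : ℝ) * Complex.exp (Real.pi * w ^ 2 / 2) : ℂ) •
    ((Real.pi * w) • gaussShift w - SchwartzMap.derivCLM ℂ ℂ (gaussShift w))

theorem hasDerivAt_fockFactor (w : ℂ) :
    HasDerivAt (fun w : ℂ => (((2 : ℝ) ^ (1 / 4 : ℝ) : ℝ) * Complex.exp (Real.pi * w ^ 2 / 2) : ℂ))
      ((((2 : ℝ) ^ (1 / 4 : ℝ) : ℝ) * Complex.exp (Real.pi * w ^ 2 / 2) : ℂ) * (Real.pi * w)) w := by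
  have h1 : HasDerivAt (fun w : ℂ => (Real.pi : ℂ) * w ^ 2 / 2) (Real.pi * w) w := by
    have := ((hasDerivAt_pow 2 w).const_mul (Real.pi : ℂ)).div_const 2
    refine this.congr_deriv ?_
    simp
    ring
  exact (h1.cexp.const_mul _).congr_deriv (by ring)

theorem hasDerivAt_apply_fockAtom (u : 𝓢'(ℝ, ℂ)) (w : ℂ) :
    HasDerivAt (fun w => u (fockAtom w)) (u (fockAtomDeriv w)) w := by
  have h := (hasDerivAt_fockFactor w).mul (hasDerivAt_apply_gaussShift u w)
  simp only [fockAtom, fockAtomDeriv, map_smul, map_sub, smul_eq_mul]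
  refine h.congr_deriv ?_
  ring

theorem two_rpow_quarter_sq : (((2 : ℝ) ^ (1 / 4 : ℝ) : ℝ) : ℂ) ^ 2 = ((Real.sqrt 2 : ℝ) : ℂ) := by
  rw [← Complex.ofReal_pow, ← Real.rpow_natCast, ← Real.rpow_mul (by norm_num), Real.sqrt_eq_rpow]
  norm_num

theorem fockAtom_apply (w : ℂ) (t : ℝ) : fockAtom w t = (((2 : ℝ) ^ (1 / 4 : ℝ) : ℝ) : ℂ) *
    Complex.exp (-(Real.pi : ℂ) * (t : ℂ) ^ 2 + 2 * Real.pi * w * t - Real.pi * w ^ 2 / 2) := by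
  rw [fockAtom, _root_.smul_apply, gaussShift_apply, entireGauss, smul_eq_mul, mul_assoc,
    ← Complex.exp_add]
  congr 2
  ring

/-- The reproducing kernel of the Fock space. -/
theorem l2Inner_fockAtom (w v : ℂ) :
    l2Inner (fockAtom w) (fockAtom v) = Complex.exp (Real.pi * w * star v) := by
  have hpi : (Real.pi : ℂ) ≠ 0 := by exact_mod_cast Real.pi_ne_zero
  have e : ∀ t : ℝ, fockAtom w t * star (fockAtom v t) = ((Real.sqrt 2 : ℝ) : ℂ) *
      Complex.exp ((-2 * Real.pi : ℂ) * (t : ℂ) ^ 2 + (2 * Real.pi * (w + star v)) * t +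
        -(Real.pi * (w ^ 2 + star v ^ 2) / 2)) := fun t => by
    rw [fockAtom_apply, fockAtom_apply, star_mul', RCLike.star_def, ← Complex.exp_conj,
      Complex.conj_ofReal, ← two_rpow_quarter_sq]
    rw [mul_mul_mul_comm, ← sq, ← Complex.exp_add]
    congr 2
    simp only [map_sub, map_add, map_mul, map_neg, map_div₀, map_pow, Complex.conj_ofReal,
      Complex.conj_ofNat]
    ring
  simp only [l2Inner, e]
  rw [integral_const_mul, integral_cexp_quadratic (by simp [Real.pi_pos])]
  have h1 : ((Real.pi : ℂ) / -(-2 * Real.pi)) ^ (1 / 2 : ℂ) = ((Real.sqrt 2 : ℝ) : ℂ)⁻¹ := by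
    have : (Real.pi : ℂ) / -(-2 * Real.pi) = ((1 / 2 : ℝ) : ℂ) := by
      push_cast
      field_simp
    rw [this, show (1 / 2 : ℂ) = ((1 / 2 : ℝ) : ℂ) by push_cast; rfl,
      ← Complex.ofReal_cpow (by norm_num), ← Real.sqrt_eq_rpow, Real.sqrt_div zero_le_one]
    simp
  rw [h1, ← mul_assoc, mul_inv_cancel₀ (by simp), one_mul]
  congr 1
  field_simp
  ring

/-- Pairing with `conj ψ`, as a tempered distribution. -/
noncomputable def l2InnerDistribution (ψ : 𝓢(ℝ, ℂ)) : 𝓢'(ℝ, ℂ) :=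
  toTemperedDistributionCLM ℝ ℂ volume
    (SchwartzMap.postcompCLM (𝕜 := ℝ) (Complex.conjCLE : ℂ →L[ℝ] ℂ) ψ)

theorem l2InnerDistribution_apply (ψ φ : 𝓢(ℝ, ℂ)) : l2InnerDistribution ψ φ = l2Inner φ ψ :=
  (toTemperedDistributionCLM_apply_apply volume
    (SchwartzMap.postcompCLM (𝕜 := ℝ) (Complex.conjCLE : ℂ →L[ℝ] ℂ) ψ) φ).trans rfl

theorem hasDerivAt_l2Inner_fockAtom (ψ : 𝓢(ℝ, ℂ)) (w : ℂ) :
    HasDerivAt (fun w => l2Inner (fockAtom w) ψ) (l2Inner (fockAtomDeriv w) ψ) w := by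
  simpa only [l2InnerDistribution_apply] using hasDerivAt_apply_fockAtom (l2InnerDistribution ψ) w

/-- Derivatives of the reproducing kernel, obtained by differentiating `l2Inner_fockAtom` rather than
by computing further integrals. -/
theorem l2Inner_fockAtomDeriv_left (w v : ℂ) : l2Inner (fockAtomDeriv w) (fockAtom v) =
    Real.pi * star v * Complex.exp (Real.pi * w * star v) := by
  have h := hasDerivAt_l2Inner_fockAtom (fockAtom v) w
  simp only [l2Inner_fockAtom] at h
  have h2 : HasDerivAt (fun w : ℂ => Complex.exp (Real.pi * w * star v))
      (Complex.exp (Real.pi * w * star v) * (Real.pi * 1 * star v)) w :=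
    (((hasDerivAt_id w).const_mul (Real.pi : ℂ)).mul_const (star v)).cexp
  rw [h.unique h2]
  ring

theorem l2Inner_fockAtomDeriv (w : ℂ) : l2Inner (fockAtomDeriv w) (fockAtomDeriv w) =
    (Real.pi + Real.pi ^ 2 * w * star w) * Complex.exp (Real.pi * w * star w) := by
  have h := hasDerivAt_l2Inner_fockAtom (fockAtomDeriv w) w
  have e : ∀ v, l2Inner (fockAtom v) (fockAtomDeriv w) =
      (Real.pi * v) * Complex.exp (Real.pi * v * star w) := fun v => by
    rw [← star_l2Inner, l2Inner_fockAtomDeriv_left, star_mul', star_mul', star_star]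
    simp only [RCLike.star_def, ← Complex.exp_conj, map_mul, Complex.conj_ofReal, Complex.conj_conj]
    congr 2
    ring
  simp only [e] at h
  have h2 : HasDerivAt (fun v : ℂ => Complex.exp (Real.pi * v * star w))
      (Complex.exp (Real.pi * w * star w) * (Real.pi * 1 * star w)) w :=
    (((hasDerivAt_id w).const_mul (Real.pi : ℂ)).mul_const (star w)).cexp
  have h3 : HasDerivAt (fun v : ℂ => (Real.pi : ℂ) * v) (Real.pi * 1) w :=
    (hasDerivAt_id w).const_mul (Real.pi : ℂ)
  rw [h.unique (h3.mul h2)]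
  ring

/-- The nonvanishing factor, of modulus `e^{-π|z|²/2}`, between `gaborAtom z` and
`fockAtom (star z)`. -/
noncomputable def gaborFactor (z : ℂ) : ℂ :=
  Complex.exp (-(Real.pi * ‖z‖ ^ 2 / 2 : ℝ) - (Real.pi * z.re * z.im : ℝ) * Complex.I)

theorem gaborAtom_eq_smul (z : ℂ) : gaborAtom z = gaborFactor z • fockAtom (star z) := by
  ext t
  have h1 : gaborAtom z t = gaborFun z t := rfl
  rw [h1, _root_.smul_apply, fockAtom_apply, gaborFun, gaussWindow, gaborFactor, smul_eq_mul,
    mul_left_comm, ← Complex.exp_add, Complex.ofReal_mul, Complex.ofReal_exp, mul_assoc,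
    ← Complex.exp_add, ← Complex.normSq_eq_norm_sq, Complex.normSq_apply]
  congr 2
  have hz : star z = (z.re : ℂ) - z.im * Complex.I := by
    apply Complex.ext <;> simp
  rw [hz]
  push_cast
  ring_nf
  rw [Complex.I_sq]
  ring

theorem norm_gaborFactor_sq (z : ℂ) : ‖gaborFactor z‖ ^ 2 = Real.exp (-Real.pi * ‖z‖ ^ 2) := by
  rw [gaborFactor, Complex.norm_exp, ← Real.exp_nat_mul]
  congr 1
  simp only [Nat.cast_ofNat, Complex.sub_re, Complex.neg_re, Complex.ofReal_re, Complex.mul_re,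
    Complex.I_re, mul_zero, Complex.ofReal_im, Complex.I_im, mul_one, sub_self, sub_zero]
  ring

theorem gaborFactor_ne_zero (z : ℂ) : gaborFactor z ≠ 0 := Complex.exp_ne_zero _

/-! ### The transform of the deterministic signal -/

theorem toFunctional_smul (x : ℝ → ℂ) (a : ℂ) (φ : 𝓢(ℝ, ℂ)) :
    toFunctional x (a • φ) = a * toFunctional x φ := by
  simp only [toFunctional, _root_.smul_apply, smul_eq_mul]
  rw [← integral_const_mul]
  congr 1
  funext t
  ring

/-- A bound, uniform over `w` in a unit disc, for the derivative of `w ↦ e^{-π(t-w)²}`. The factor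
lost to moving `w`, at most `e^{4π|t - re w₀|}` up to a constant, is absorbed by the two real
Gaussians centred at `re w₀ ± 2`, against which the signal is integrable by assumption. -/
theorem norm_mul_entireGauss_le (w₀ : ℂ) : ∃ C : ℝ, ∀ (t : ℝ) (w : ℂ), ‖w - w₀‖ ≤ 1 →
    ‖2 * (Real.pi : ℂ) * (t - w) * entireGauss (t - w)‖ ≤
      C * (Real.exp (-Real.pi * (t - (w₀.re + 2)) ^ 2) +
        Real.exp (-Real.pi * (t - (w₀.re - 2)) ^ 2)) := by
  set R : ℝ := |w₀.im| + 1 with hR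
  refine ⟨2 * Real.pi * (1 + R) * Real.exp (Real.pi * R ^ 2 + 4 * Real.pi), fun t w hw => ?_⟩
  have hpi := Real.pi_gt_three
  set a : ℝ := t - w₀.re with ha
  set s : ℝ := (w - w₀).re with hs
  have hs1 : |s| ≤ 1 := (Complex.abs_re_le_norm _).trans hw
  have him : |w.im| ≤ R := by
    have h1 : |(w - w₀).im| ≤ 1 := (Complex.abs_im_le_norm _).trans hw
    have h2 : w.im = w₀.im + (w - w₀).im := by simp
    rw [h2]
    exact (abs_add_le _ _).trans (by rw [hR]; gcongr)
  have him2 : w.im ^ 2 ≤ R ^ 2 :=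
    sq_le_sq' (by linarith [neg_abs_le w.im]) ((le_abs_self _).trans him)
  have hre : ((t : ℂ) - w).re = a - s := by simp [ha, hs]
  have hR0 : 0 ≤ R := by positivity
  have hnorm : ‖(t : ℂ) - w‖ ≤ (1 + R) * Real.exp (2 * Real.pi * |a|) := by
    have h1 : ‖(t : ℂ) - w‖ ≤ |a - s| + |w.im| := by
      have := Complex.norm_le_abs_re_add_abs_im ((t : ℂ) - w)
      rw [hre] at this
      simpa using this
    have h2 : |a - s| ≤ |a| + 1 := (abs_sub _ _).trans (by gcongr)
    have h3 : 1 + |a| ≤ Real.exp (2 * Real.pi * |a|) := by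
      have := Real.add_one_le_exp (2 * Real.pi * |a|)
      nlinarith [abs_nonneg a]
    calc ‖(t : ℂ) - w‖ ≤ (1 + R) * (1 + |a|) := by nlinarith [abs_nonneg a]
      _ ≤ _ := by gcongr
  have hgauss : ‖entireGauss ((t : ℂ) - w)‖ ≤
      Real.exp (-Real.pi * a ^ 2 + 2 * Real.pi * |a| + Real.pi * R ^ 2) := by
    rw [entireGauss, Complex.norm_exp, Real.exp_le_exp]
    have e : (-(Real.pi : ℂ) * ((t : ℂ) - w) ^ 2).re =
        -Real.pi * ((a - s) ^ 2 - w.im ^ 2) := by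
      rw [← hre, ← Complex.ofReal_neg, Complex.re_ofReal_mul]
      simp [sq]
    rw [e]
    have h4 : a * s ≤ |a| := by
      calc a * s ≤ |a * s| := le_abs_self _
        _ = |a| * |s| := abs_mul _ _
        _ ≤ |a| * 1 := by gcongr
        _ = |a| := mul_one _
    nlinarith [sq_nonneg s]
  have hsum : Real.exp (-Real.pi * a ^ 2 + 4 * Real.pi * |a|) ≤ Real.exp (4 * Real.pi) *
      (Real.exp (-Real.pi * (t - (w₀.re + 2)) ^ 2) +
        Real.exp (-Real.pi * (t - (w₀.re - 2)) ^ 2)) := by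
    rw [mul_add, ← Real.exp_add, ← Real.exp_add]
    have ea : t = a + w₀.re := by rw [ha]; ring
    rcases abs_cases a with ⟨h, -⟩ | ⟨h, -⟩
    · refine le_trans (le_of_eq ?_) (le_add_of_nonneg_right (Real.exp_pos _).le)
      rw [h, ea]; ring_nf
    · refine le_trans (le_of_eq ?_) (le_add_of_nonneg_left (Real.exp_pos _).le)
      rw [h, ea]; ring_nf
  have h2pi : ‖(2 * (Real.pi : ℂ))‖ = 2 * Real.pi := by
    rw [norm_mul, Complex.norm_real, Real.norm_of_nonneg Real.pi_pos.le]; simp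
  rw [norm_mul, norm_mul, h2pi]
  calc 2 * Real.pi * ‖(t : ℂ) - w‖ * ‖entireGauss ((t : ℂ) - w)‖
      ≤ 2 * Real.pi * ((1 + R) * Real.exp (2 * Real.pi * |a|)) *
        Real.exp (-Real.pi * a ^ 2 + 2 * Real.pi * |a| + Real.pi * R ^ 2) := by gcongr
    _ = 2 * Real.pi * (1 + R) * Real.exp (Real.pi * R ^ 2) *
        Real.exp (-Real.pi * a ^ 2 + 4 * Real.pi * |a|) := by
        have : Real.exp (2 * Real.pi * |a|) *
            Real.exp (-Real.pi * a ^ 2 + 2 * Real.pi * |a| + Real.pi * R ^ 2) =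
            Real.exp (Real.pi * R ^ 2) * Real.exp (-Real.pi * a ^ 2 + 4 * Real.pi * |a|) := by
          rw [← Real.exp_add, ← Real.exp_add]; ring_nf
        linear_combination (2 * Real.pi * (1 + R)) * this
    _ ≤ 2 * Real.pi * (1 + R) * Real.exp (Real.pi * R ^ 2) * (Real.exp (4 * Real.pi) *
        (Real.exp (-Real.pi * (t - (w₀.re + 2)) ^ 2) +
          Real.exp (-Real.pi * (t - (w₀.re - 2)) ^ 2))) := by gcongr
    _ = _ := by rw [Real.exp_add]; ring

theorem integrable_norm_mul_exp {x : ℝ → ℂ}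
    (hx : ∀ τ : ℝ, Integrable (fun t : ℝ => x t * (gaussWindow (t - τ) : ℂ)) volume) (τ : ℝ) :
    Integrable (fun t : ℝ => ‖x t‖ * Real.exp (-Real.pi * (t - τ) ^ 2)) volume := by
  refine ((hx τ).norm.const_mul ((2 : ℝ) ^ (1 / 4 : ℝ))⁻¹).congr
    (Filter.Eventually.of_forall fun t => ?_)
  have h : (0 : ℝ) < (2 : ℝ) ^ (1 / 4 : ℝ) := by positivity
  simp only [gaussWindow, norm_mul, Complex.norm_real, Real.norm_eq_abs,
    abs_of_pos h, abs_of_pos (Real.exp_pos _)]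
  field_simp

/-- The transform of the deterministic signal is an entire function. -/
theorem differentiable_toFunctional_fockAtom {x : ℝ → ℂ} (hx_loc : LocallyIntegrable x volume)
    (hx : ∀ τ : ℝ, Integrable (fun t : ℝ => x t * (gaussWindow (t - τ) : ℂ)) volume) :
    Differentiable ℂ fun w => toFunctional x (fockAtom w) := by
  simp only [fockAtom, toFunctional_smul]
  refine Differentiable.mul (fun w => (hasDerivAt_fockFactor w).differentiableAt) fun w₀ => ?_
  obtain ⟨C, hC⟩ := norm_mul_entireGauss_le w₀
  have hxm := hx_loc.aestronglyMeasurable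
  have hcont : ∀ w : ℂ, Continuous fun t : ℝ => entireGauss (t - w) := fun w => by
    unfold entireGauss; fun_prop
  have hmeas : ∀ w : ℂ, AEStronglyMeasurable (fun t : ℝ => x t * entireGauss (t - w)) volume :=
    fun w => hxm.mul (hcont w).aestronglyMeasurable
  have hint : Integrable (fun t : ℝ => x t * entireGauss (t - w₀)) volume := by
    refine ((integrable_norm_mul_exp hx w₀.re).const_mul
      (Real.exp (Real.pi * w₀.im ^ 2))).mono' (hmeas w₀) (Filter.Eventually.of_forall fun t => ?_)
    have e : (-(Real.pi : ℂ) * ((t : ℂ) - w₀) ^ 2).re =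
        Real.pi * w₀.im ^ 2 + -Real.pi * (t - w₀.re) ^ 2 := by
      rw [← Complex.ofReal_neg, Complex.re_ofReal_mul]
      simp [sq]
      ring
    rw [norm_mul, entireGauss, Complex.norm_exp, e, Real.exp_add]
    exact le_of_eq (by ring)
  have hbound : Integrable (fun t : ℝ => C * (‖x t‖ * Real.exp (-Real.pi * (t - (w₀.re + 2)) ^ 2) +
      ‖x t‖ * Real.exp (-Real.pi * (t - (w₀.re - 2)) ^ 2))) volume :=
    ((integrable_norm_mul_exp hx _).add (integrable_norm_mul_exp hx _)).const_mul C
  have h := hasDerivAt_integral_of_dominated_loc_of_deriv_le (𝕜 := ℂ) (μ := (volume : Measure ℝ))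
    (F := fun w (t : ℝ) => x t * entireGauss (t - w))
    (F' := fun w (t : ℝ) => x t * (2 * (Real.pi : ℂ) * (t - w) * entireGauss (t - w)))
    (x₀ := w₀) (Metric.closedBall_mem_nhds w₀ one_pos) (Filter.Eventually.of_forall hmeas) hint
    (hxm.mul (Continuous.aestronglyMeasurable (by have := hcont w₀; fun_prop)))
    (Filter.Eventually.of_forall fun t w hw => by
      rw [norm_mul]
      refine (mul_le_mul_of_nonneg_left (hC t w (by simpa [dist_eq_norm] using hw))
        (norm_nonneg _)).trans (le_of_eq ?_)
      ring)
    hbound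
    (Filter.Eventually.of_forall fun t w _ => by
      have h1 : HasDerivAt (fun w : ℂ => -(Real.pi : ℂ) * ((t : ℂ) - w) ^ 2)
          (2 * (Real.pi : ℂ) * (t - w)) w := by
        have := (((hasDerivAt_id w).const_sub (t : ℂ)).pow 2).const_mul (-(Real.pi : ℂ))
        refine this.congr_deriv ?_
        simp
        ring
      exact (h1.cexp.const_mul (x t)).congr_deriv (by rw [entireGauss]; ring))
  exact h.2.differentiableAt

/-! ### The Laplacian of the spectrogram -/

/-- The second derivative in a direction, computed along the line through `z` in that direction. -/
theorem iteratedFDeriv_two_apply_self {f f₁ : ℝ → ℝ} {g : ℂ → ℝ} (hg : ContDiff ℝ 2 g) {z v : ℂ}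
    {f₂ : ℝ} (hf : ∀ s : ℝ, g (z + s • v) = f s) (h1 : ∀ s, HasDerivAt f (f₁ s) s)
    (h2 : HasDerivAt f₁ f₂ 0) : iteratedFDeriv ℝ 2 g z ![v, v] = f₂ := by
  have hline : ∀ s : ℝ, HasDerivAt (fun s : ℝ => z + s • v) v s := fun s => by
    have := ((hasDerivAt_id s).smul_const v).const_add z
    simpa using this
  have hd : Differentiable ℝ g := hg.differentiable two_ne_zero
  have hd2 : Differentiable ℝ (fderiv ℝ g) :=
    (hg.fderiv_right (m := 1) (by norm_num)).differentiable one_ne_zero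
  have e1 : ∀ s, f₁ s = fderiv ℝ g (z + s • v) v := fun s => by
    have h := (hd (z + s • v)).hasFDerivAt.comp_hasDerivAt s (hline s)
    have h' : g ∘ (fun s : ℝ => z + s • v) = f := funext hf
    rw [h'] at h
    exact (h1 s).unique h
  have h3 := (hd2 (z + (0 : ℝ) • v)).hasFDerivAt.comp_hasDerivAt 0 (hline 0)
  have h4 := h3.clm_apply (hasDerivAt_const (0 : ℝ) v)
  have h5 : (fun s => ((fderiv ℝ g) ∘ fun s : ℝ => z + s • v) s v) = f₁ :=
    funext fun s => (e1 s).symm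
  simp only [h5] at h4
  rw [iteratedFDeriv_two_apply, h2.unique h4]
  simp

/-- The function `z ↦ |M(conj z)|² e^{-π|z|²}` attached to an entire function `M`. -/
noncomputable def fockSpec (M : ℂ → ℂ) (z : ℂ) : ℝ :=
  ‖M (star z)‖ ^ 2 * Real.exp (-Real.pi * ‖z‖ ^ 2)

theorem contDiff_fockSpec {M : ℂ → ℂ} (hM : Differentiable ℂ M) : ContDiff ℝ 2 (fockSpec M) := by
  have h1 : ContDiff ℝ 2 M := (hM.contDiff (n := 2)).restrict_scalars ℝ
  have h2 : ContDiff ℝ 2 (fun z : ℂ => star z) := Complex.conjCLE.contDiff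
  exact ((h1.comp h2).norm_sq ℝ).mul (contDiff_const.mul (contDiff_id.norm_sq ℝ)).exp

/-- Second derivative of `fockSpec M` in the direction `v`. -/
theorem iteratedFDeriv_fockSpec {M : ℂ → ℂ} (hM : Differentiable ℂ M) (z v : ℂ) :
    iteratedFDeriv ℝ 2 (fockSpec M) z ![v, v] =
      (2 * (inner ℝ (M (star z)) (deriv (deriv M) (star z) * star v * star v) +
          ‖deriv M (star z) * star v‖ ^ 2) -
        2 * Real.pi * ‖v‖ ^ 2 * ‖M (star z)‖ ^ 2 -
        8 * Real.pi * inner ℝ z v * inner ℝ (M (star z)) (deriv M (star z) * star v) +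
        4 * Real.pi ^ 2 * (inner ℝ z v) ^ 2 * ‖M (star z)‖ ^ 2) *
      Real.exp (-Real.pi * ‖z‖ ^ 2) := by
  have hM1 : Differentiable ℂ (deriv M) :=
    (contDiff_succ_iff_deriv.1 (show ContDiff ℂ (1 + 1) M from hM.contDiff)).2.2.differentiable
      one_ne_zero
  let W : ℝ → ℂ := fun s => star z + s * star v
  have hW : ∀ s : ℝ, HasDerivAt W (star v) s := fun s => by
    have := (((hasDerivAt_id (s : ℂ)).mul_const (star v)).const_add (star z)).comp_ofReal
    simpa [W] using this
  have hline : ∀ s : ℝ, HasDerivAt (fun s : ℝ => z + s • v) v s := fun s => by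
    have := ((hasDerivAt_id s).smul_const v).const_add z
    simpa using this
  have hMW : ∀ s, HasDerivAt (fun s => M (W s)) (deriv M (W s) * star v) s := fun s =>
    (hM (W s)).hasDerivAt.comp s (hW s)
  have hM1W : ∀ s, HasDerivAt (fun s => deriv M (W s) * star v)
      (deriv (deriv M) (W s) * star v * star v) s := fun s =>
    ((hM1 (W s)).hasDerivAt.comp s (hW s)).mul_const _
  have hP := fun s => (hMW s).norm_sq
  have hP1 := fun s => ((hMW s).inner ℝ (hM1W s)).const_mul 2
  have hq := fun s => (hline s).norm_sq
  have hq1 := fun s => ((hline s).inner ℝ (hasDerivAt_const s v)).const_mul 2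
  have hE := fun s => ((hq s).const_mul (-Real.pi)).exp
  have h1 := fun s => (hP s).mul (hE s)
  have h2 := ((hP1 0).mul (hE 0)).add ((hP 0).mul ((hE 0).mul ((hq1 0).const_mul (-Real.pi))))
  rw [iteratedFDeriv_two_apply_self (contDiff_fockSpec hM) (fun s => ?_) h1 h2]
  · simp only [W, Pi.mul_apply, Complex.ofReal_zero, zero_mul, add_zero, zero_smul,
      inner_zero_right, zero_add,
      real_inner_self_eq_norm_sq]
    ring
  · simp [fockSpec, W]

theorem laplacian_fockSpec {M : ℂ → ℂ} (hM : Differentiable ℂ M) (z : ℂ) :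
    Laplacian.laplacian (fockSpec M) z =
      4 * Real.exp (-Real.pi * ‖z‖ ^ 2) *
        ‖deriv M (star z) - Real.pi * z * M (star z)‖ ^ 2 - 4 * Real.pi * fockSpec M z := by
  rw [InnerProductSpace.laplacian_eq_iteratedFDeriv_complexPlane]
  simp only
  rw [iteratedFDeriv_fockSpec hM, iteratedFDeriv_fockSpec hM, fockSpec]
  generalize M (star z) = m
  generalize deriv M (star z) = m₁
  generalize deriv (deriv M) (star z) = m₂
  generalize Real.exp (-Real.pi * ‖z‖ ^ 2) = E
  simp only [Complex.inner, ← Complex.normSq_eq_norm_sq, Complex.normSq_apply, RCLike.star_def,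
    Complex.mul_re, Complex.mul_im, Complex.sub_re, Complex.sub_im, Complex.conj_re,
    Complex.conj_im, Complex.one_re, Complex.one_im, Complex.I_re, Complex.I_im,
    Complex.ofReal_re, Complex.ofReal_im]
  ring

/-- The intensity of the zeros, in terms of the entire function `M`. -/
theorem intensity_fockSpec {M : ℂ → ℂ} (hM : Differentiable ℂ M) (z : ℂ) :
    (1 + fockSpec M z + Laplacian.laplacian (fockSpec M) z / (4 * Real.pi)) *
        Real.exp (-fockSpec M z) =
      (1 + Real.exp (-Real.pi * ‖z‖ ^ 2) *
        ‖deriv M (star z) - Real.pi * z * M (star z)‖ ^ 2 / Real.pi) *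
        Real.exp (-fockSpec M z) := by
  rw [laplacian_fockSpec hM]
  have := Real.pi_ne_zero
  congr 1
  field_simp
  ring

/-! ### The expected number of zeros -/

/-- The space of entire functions, with the σ-algebra generated by the evaluations. -/
abbrev EntireFun : Type := {h : ℂ → ℂ // Differentiable ℂ h}

/-- Fubini for a function of two independent variables. -/
theorem lintegral_comp_of_indepFun {Ω α β : Type*} [MeasurableSpace Ω] [MeasurableSpace α]
    [MeasurableSpace β] {μ : Measure Ω} [IsProbabilityMeasure μ] {T : Ω → α} {Y : Ω → β}
    (hT : Measurable T) (hY : Measurable Y) (h : IndepFun T Y μ) {g : α × β → ℝ≥0∞}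
    (hg : Measurable g) :
    ∫⁻ ω, g (T ω, Y ω) ∂μ = ∫⁻ ω, ∫⁻ y, g (T ω, y) ∂(μ.map Y) ∂μ := by
  have := Measure.isProbabilityMeasure_map (μ := μ) hY.aemeasurable
  have := Measure.isProbabilityMeasure_map (μ := μ) hT.aemeasurable
  rw [← lintegral_map (f := g) (g := fun ω => (T ω, Y ω)) hg (hT.prodMk hY),
    (indepFun_iff_map_prod_eq_prod_map_map hT.aemeasurable hY.aemeasurable).1 h,
    lintegral_prod _ hg.aemeasurable, lintegral_map hg.lintegral_prod_right' hT]

section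

variable {Ω : Type*} [MeasurableSpace Ω] {μ : Measure Ω} {ξ : Ω → 𝓢'(ℝ, ℂ)}

theorem differentiable_apply_fockAtom (u : 𝓢'(ℝ, ℂ)) : Differentiable ℂ fun w => u (fockAtom w) :=
  fun w => (hasDerivAt_apply_fockAtom u w).differentiableAt

theorem continuous_apply_fockAtomDeriv (u : 𝓢'(ℝ, ℂ)) :
    Continuous fun w => u (fockAtomDeriv w) := by
  have h := ((differentiable_apply_fockAtom u).contDiff (n := 1)).continuous_deriv le_rfl
  have e : deriv (fun w => u (fockAtom w)) = fun w => u (fockAtomDeriv w) :=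
    funext fun w => (hasDerivAt_apply_fockAtom u w).deriv
  rwa [e] at h

theorem mul_star_eq (w : ℂ) : w * star w = ((‖w‖ ^ 2 : ℝ) : ℂ) := by
  rw [RCLike.star_def, Complex.mul_conj, Complex.normSq_eq_norm_sq]

theorem l2Inner_fockAtom_sub (w : ℂ) :
    l2Inner (fockAtom w - fockAtom 0) (fockAtom w - fockAtom 0) =
      ((Real.exp (Real.pi * ‖w‖ ^ 2) - 1 : ℝ) : ℂ) := by
  simp only [l2Inner_sub_left, l2Inner_sub_right, l2Inner_fockAtom, star_zero, mul_zero, zero_mul,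
    Complex.exp_zero]
  rw [mul_assoc, mul_star_eq]
  push_cast
  ring

theorem l2Inner_fockAtomDeriv_sub (w : ℂ) :
    l2Inner (fockAtomDeriv w) (fockAtom w - fockAtom 0) =
      Real.pi * star w * (Real.exp (Real.pi * ‖w‖ ^ 2) : ℝ) := by
  simp only [l2Inner_sub_right, l2Inner_fockAtomDeriv_left, star_zero, mul_zero, zero_mul]
  rw [mul_assoc (Real.pi : ℂ) w, mul_star_eq]
  push_cast
  ring

/-- The regression coefficient of `⟨ξ, fockAtomDeriv w⟩` on `⟨ξ, fockAtom w - fockAtom 0⟩`. -/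
noncomputable def regressionCoeff (w : ℂ) : ℂ :=
  Real.pi * star w * (Real.exp (Real.pi * ‖w‖ ^ 2) / (Real.exp (Real.pi * ‖w‖ ^ 2) - 1) : ℝ)

theorem exp_sub_one_pos {w : ℂ} (hw : w ≠ 0) : 0 < Real.exp (Real.pi * ‖w‖ ^ 2) - 1 := by
  have : 0 < ‖w‖ := norm_pos_iff.2 hw
  have := Real.add_one_lt_exp (x := Real.pi * ‖w‖ ^ 2) (by positivity)
  have := Real.pi_pos
  have : 0 < Real.pi * ‖w‖ ^ 2 := by positivity
  linarith

theorem l2Inner_residual_left {w : ℂ} (hw : w ≠ 0) :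
    l2Inner (fockAtomDeriv w - regressionCoeff w • (fockAtom w - fockAtom 0))
      (fockAtom w - fockAtom 0) = 0 := by
  rw [l2Inner_sub_left, l2Inner_smul_left, l2Inner_fockAtom_sub, l2Inner_fockAtomDeriv_sub,
    regressionCoeff, mul_assoc ((Real.pi : ℂ) * star w), ← Complex.ofReal_mul,
    div_mul_cancel₀ _ (exp_sub_one_pos hw).ne',
    sub_self]

theorem integral_residual {w : ℂ} (hw : w ≠ 0) :
    ∫ t : ℝ, ‖(fockAtomDeriv w - regressionCoeff w • (fockAtom w - fockAtom 0)) t‖ ^ 2 =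
      (Real.pi + Real.pi ^ 2 * ‖w‖ ^ 2) * Real.exp (Real.pi * ‖w‖ ^ 2) -
        Real.pi ^ 2 * ‖w‖ ^ 2 * Real.exp (Real.pi * ‖w‖ ^ 2) ^ 2 /
          (Real.exp (Real.pi * ‖w‖ ^ 2) - 1) := by
  have h1 := l2Inner_residual_left hw
  set φ := fockAtom w - fockAtom 0 with hφ
  have h2 : l2Inner φ (fockAtomDeriv w) =
      Real.pi * w * (Real.exp (Real.pi * ‖w‖ ^ 2) : ℝ) := by
    rw [← star_l2Inner, hφ, l2Inner_fockAtomDeriv_sub]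
    simp only [RCLike.star_def, map_mul, Complex.conj_ofReal, Complex.conj_conj]
  have hs : ((Real.exp (Real.pi * ‖w‖ ^ 2) - 1 : ℝ) : ℂ) ≠ 0 := by
    exact_mod_cast (exp_sub_one_pos hw).ne'
  rw [integral_norm_sq_eq_re, ← Complex.ofReal_re (_ - _)]
  congr 1
  conv_lhs => rw [l2Inner_sub_right, l2Inner_smul_right, h1, mul_zero, sub_zero, l2Inner_sub_left,
    l2Inner_smul_left, h2, l2Inner_fockAtomDeriv, mul_assoc (_ ^ 2) w, mul_assoc (Real.pi : ℂ) w,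
    mul_star_eq, regressionCoeff]
  have h3 : (Real.pi : ℂ) * star w *
      ((Real.exp (Real.pi * ‖w‖ ^ 2) / (Real.exp (Real.pi * ‖w‖ ^ 2) - 1) : ℝ) : ℂ) *
        (Real.pi * w * (Real.exp (Real.pi * ‖w‖ ^ 2) : ℝ)) = (Real.pi : ℂ) ^ 2 * (w * star w) *
      ((Real.exp (Real.pi * ‖w‖ ^ 2) / (Real.exp (Real.pi * ‖w‖ ^ 2) - 1) : ℝ) : ℂ) *
        (Real.exp (Real.pi * ‖w‖ ^ 2) : ℝ) := by ring
  rw [h3, mul_star_eq]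
  push_cast
  ring

/-- Gaussian expectation of `|f'(w)|² p(f(w))`, where `f = -(M + ⟨ξ, fockAtom - fockAtom 0⟩)` and
`p` is the density of `⟨ξ, fockAtom 0⟩`. Given `⟨ξ, fockAtom w - fockAtom 0⟩`, the derivative of
the noise splits into its regression and an independent residual. -/
theorem IsComplexWhiteNoise.lintegral_jacobian [IsProbabilityMeasure μ]
    (hξ : IsComplexWhiteNoise μ ξ) {w : ℂ} (hw : w ≠ 0) (a b : ℂ) :
    ∫⁻ ω, ENNReal.ofReal (‖b + ξ ω (fockAtomDeriv w)‖ ^ 2) *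
      ENNReal.ofReal (cgaussPDF 1 (a + ξ ω (fockAtom w - fockAtom 0))) ∂μ =
    ENNReal.ofReal ((1 + Real.exp (-Real.pi * ‖w‖ ^ 2) * ‖b - Real.pi * star w * a‖ ^ 2 / Real.pi) *
      Real.exp (-(‖a‖ ^ 2 * Real.exp (-Real.pi * ‖w‖ ^ 2)))) := by
  set φ := fockAtom w - fockAtom 0 with hφ
  set α := regressionCoeff w with hα
  set χ := fockAtomDeriv w - α • φ with hχ
  set K := Real.exp (Real.pi * ‖w‖ ^ 2) with hK
  have hs : 0 < K - 1 := exp_sub_one_pos hw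
  have hKpos : 0 < K := Real.exp_pos _
  have hχφ : l2Inner χ φ = 0 := l2Inner_residual_left hw
  have hφχ : l2Inner φ χ = 0 := by rw [← star_l2Inner, hχφ, star_zero]
  have hφn : ∫ t : ℝ, ‖φ t‖ ^ 2 = K - 1 := by
    rw [integral_norm_sq_eq_re, l2Inner_fockAtom_sub, Complex.ofReal_re]
  have hχn := integral_residual hw
  rw [← hφ, ← hα, ← hχ, ← hK] at hχn
  set t := ∫ t : ℝ, ‖χ t‖ ^ 2 with ht
  have ht0 : 0 ≤ t := integral_nonneg fun _ => sq_nonneg _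
  have hdec : ∀ ω, b + ξ ω (fockAtomDeriv w) = (b + α * ξ ω φ) + ξ ω χ := fun ω => by
    have h : ξ ω χ = ξ ω (fockAtomDeriv w) - α * ξ ω φ := by
      rw [hχ, map_sub, map_smul, smul_eq_mul]
    rw [h]
    ring
  have hind : IndepFun (fun ω => ξ ω φ) (fun ω => ξ ω χ) μ :=
    (hξ.indepFun_of_orthogonal (fun _ : Unit => φ) χ fun _ => hφχ).comp
      (measurable_pi_apply ()) measurable_id
  have hmφ := hξ.measurable_apply φ
  have hmχ := hξ.measurable_apply χ
  have hmg : Measurable fun p : ℂ × ℂ => ENNReal.ofReal (‖(b + α * p.1) + p.2‖ ^ 2) *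
      ENNReal.ofReal (cgaussPDF 1 (a + p.1)) :=
    (Measurable.ennreal_ofReal (by fun_prop)).mul
      ((measurable_ofReal_cgaussPDF 1).comp (by fun_prop))
  simp only [hdec]
  rw [lintegral_comp_of_indepFun hmφ hmχ hind hmg]
  have hinner : ∀ z : ℂ, ∫⁻ y, ENNReal.ofReal (‖(b + α * z) + y‖ ^ 2) *
      ENNReal.ofReal (cgaussPDF 1 (a + z)) ∂(μ.map fun ω => ξ ω χ) =
      ENNReal.ofReal (1 / Real.pi) *
        ENNReal.ofReal (Real.exp (-‖a + z‖ ^ 2) * (‖b + α * z‖ ^ 2 + t)) := fun z => by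
    rw [lintegral_mul_const _ (Measurable.ennreal_ofReal (by fun_prop)),
      lintegral_map (Measurable.ennreal_ofReal (by fun_prop)) hmχ, hξ.lintegral_norm_add_sq,
      ← ENNReal.ofReal_mul (by positivity), ← ENNReal.ofReal_mul (by positivity), cgaussPDF]
    congr 1
    rw [div_one, mul_one, neg_mul, one_mul]
    ring
  simp only [hinner]
  rw [lintegral_const_mul _ (Measurable.ennreal_ofReal (by fun_prop)),
    ← lintegral_map (f := fun z => ENNReal.ofReal (Real.exp (-‖a + z‖ ^ 2) * (‖b + α * z‖ ^ 2 + t)))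
      (Measurable.ennreal_ofReal (by fun_prop)) hmφ, hξ.map_eq_cgauss φ hφn hs,
    lintegral_cgauss_tilted hs ht0, ← ENNReal.ofReal_mul (by positivity)]
  congr 1
  have hKinv : Real.exp (-Real.pi * ‖w‖ ^ 2) = K⁻¹ := by
    rw [hK, ← Real.exp_neg, neg_mul]
  have hαs : α * a * (((K - 1) / (1 + (K - 1)) : ℝ) : ℂ) = Real.pi * star w * a := by
    have : (((K / (K - 1) : ℝ) : ℂ)) * (((K - 1) / (1 + (K - 1)) : ℝ) : ℂ) = 1 := by
      rw [← Complex.ofReal_mul, add_sub_cancel, div_mul_div_cancel₀ hs.ne', div_self hKpos.ne',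
        Complex.ofReal_one]
    rw [hα, regressionCoeff, ← hK]
    linear_combination (Real.pi * star w * a) * this
  have hαn : ‖α‖ ^ 2 = Real.pi ^ 2 * ‖w‖ ^ 2 * (K / (K - 1)) ^ 2 := by
    rw [hα, regressionCoeff, ← hK, norm_mul, norm_mul, Complex.norm_real, Complex.norm_real,
      norm_star, mul_pow, mul_pow, Real.norm_eq_abs, Real.norm_eq_abs, sq_abs, sq_abs]
  rw [hαs, hαn, hχn, hKinv, add_sub_cancel, ← div_eq_mul_inv]
  have hs' := hs.ne'
  have := Real.pi_ne_zero
  field_simp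
  ring

/-- The area formula, averaged over a Gaussian shift of the level. -/
theorem lintegral_cgauss_count {G : ℂ → ℂ} (hG : Differentiable ℂ G) {A : Set ℂ}
    (hA : MeasurableSet A) (hb : Bornology.IsBounded A) :
    ∫⁻ v, count {w | G w + v = 0} A ∂(cgauss 1) =
      ∫⁻ w in A, ENNReal.ofReal (‖deriv G w‖ ^ 2) * ENNReal.ofReal (cgaussPDF 1 (G w)) := by
  have hcv : Measurable fun v => count {w | G w + v = 0} A :=
    measurable_count_zeros (G := fun v w => G w + v) (fun _ => measurable_const.add measurable_id)
      (fun v => hG.add_const v) hA hb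
  have e2 : ∀ v, {w | G w + v = 0} = {w | -G w = v} := fun v => by
    ext w
    simp only [Set.mem_ofPred_eq]
    rw [neg_eq_iff_add_eq_zero]
  rw [cgauss, lintegral_withDensity_eq_lintegral_mul _ (measurable_ofReal_cgaussPDF 1) hcv]
  simp only [Pi.mul_apply, e2, mul_comm (ENNReal.ofReal (cgaussPDF 1 _))]
  rw [lintegral_encard_fiber hG.fun_neg hA (measurable_ofReal_cgaussPDF 1)]
  refine lintegral_congr fun w => ?_
  have hder : deriv (fun w => -G w) w = -deriv G w := (hG w).hasDerivAt.fun_neg.deriv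
  simp only [hder, cgaussPDF, norm_neg]

/-- The component of the noise orthogonal to `fockAtom 0`, as a random entire function. -/
noncomputable def orthogonalNoise (u : 𝓢'(ℝ, ℂ)) : EntireFun :=
  ⟨fun w => u (fockAtom w - fockAtom 0), by
    simp only [map_sub]
    exact (differentiable_apply_fockAtom u).sub_const _⟩

theorem deriv_orthogonalNoise (u : 𝓢'(ℝ, ℂ)) (w : ℂ) :
    deriv (orthogonalNoise u).1 w = u (fockAtomDeriv w) := by
  have h := (hasDerivAt_apply_fockAtom u w).sub_const (u (fockAtom 0))
  simp only [← map_sub] at h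
  exact h.deriv

theorem IsComplexWhiteNoise.measurable_orthogonalNoise (hξ : IsComplexWhiteNoise μ ξ) :
    Measurable fun ω => orthogonalNoise (ξ ω) :=
  (measurable_pi_lambda _ fun _ => hξ.measurable_apply _).subtype_mk

theorem IsComplexWhiteNoise.indepFun_orthogonalNoise [IsProbabilityMeasure μ]
    (hξ : IsComplexWhiteNoise μ ξ) :
    IndepFun (fun ω => orthogonalNoise (ξ ω)) (fun ω => ξ ω (fockAtom 0)) μ := by
  have h := hξ.indepFun_of_orthogonal (fun w => fockAtom w - fockAtom 0) (fockAtom 0) fun w => by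
    rw [l2Inner_sub_left, l2Inner_fockAtom, l2Inner_fockAtom]; simp
  rw [IndepFun_iff_Indep] at h ⊢
  have e : MeasurableSpace.comap (fun ω => orthogonalNoise (ξ ω)) inferInstance =
      MeasurableSpace.comap (fun ω w => ξ ω (fockAtom w - fockAtom 0)) inferInstance :=
    MeasurableSpace.comap_comp (f := (Subtype.val : EntireFun → ℂ → ℂ))
  rw [e]
  exact h

/-- Averaging first over `⟨ξ, fockAtom 0⟩`, which is independent of the orthogonal component. -/
theorem IsComplexWhiteNoise.lintegral_count_zeros_eq_lintegral_lintegral [IsProbabilityMeasure μ]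
    (hξ : IsComplexWhiteNoise μ ξ) {M : ℂ → ℂ} (hM : Differentiable ℂ M) {A : Set ℂ}
    (hA : MeasurableSet A) (hb : Bornology.IsBounded A) :
    ∫⁻ ω, count {w | M w + ξ ω (fockAtom w) = 0} A ∂μ =
      ∫⁻ ω, (∫⁻ w in A, ENNReal.ofReal (‖deriv M w + ξ ω (fockAtomDeriv w)‖ ^ 2) *
        ENNReal.ofReal (cgaussPDF 1 (M w + ξ ω (fockAtom w - fockAtom 0)))) ∂μ := by
  have hlaw : μ.map (fun ω => ξ ω (fockAtom 0)) = cgauss 1 := hξ.map_eq_cgauss _ (by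
    rw [integral_norm_sq_eq_re, l2Inner_fockAtom]; simp) one_pos
  have hcm : Measurable fun p : EntireFun × ℂ => count {w | M w + p.1.1 w + p.2 = 0} A :=
    measurable_count_zeros (G := fun (p : EntireFun × ℂ) w => M w + p.1.1 w + p.2)
      (fun w => (measurable_const.add ((measurable_pi_apply w).comp
        (measurable_subtype_coe.comp measurable_fst))).add measurable_snd)
      (fun p => (hM.add p.1.2).add_const _) hA hb
  have e0 : ∀ ω, count {w | M w + ξ ω (fockAtom w) = 0} A =
      count {w | M w + (orthogonalNoise (ξ ω)).1 w + ξ ω (fockAtom 0) = 0} A := fun ω => by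
    have e : ∀ w, M w + (orthogonalNoise (ξ ω)).1 w + ξ ω (fockAtom 0) =
        M w + ξ ω (fockAtom w) := fun w => by
      have h : (orthogonalNoise (ξ ω)).1 w = ξ ω (fockAtom w) - ξ ω (fockAtom 0) :=
        map_sub (ξ ω) _ _
      rw [h]
      ring
    simp only [e]
  simp only [e0]
  rw [lintegral_comp_of_indepFun hξ.measurable_orthogonalNoise (hξ.measurable_apply _)
    hξ.indepFun_orthogonalNoise hcm, hlaw]
  refine lintegral_congr fun ω => ?_
  have hd : Differentiable ℂ fun w => M w + (orthogonalNoise (ξ ω)).1 w :=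
    hM.add (orthogonalNoise (ξ ω)).2
  have hder : ∀ w, deriv (fun w => M w + (orthogonalNoise (ξ ω)).1 w) w =
      deriv M w + ξ ω (fockAtomDeriv w) := fun w => by
    rw [← deriv_orthogonalNoise]
    exact ((hM w).hasDerivAt.add ((orthogonalNoise (ξ ω)).2 w).hasDerivAt).deriv
  refine (lintegral_cgauss_count hd hA hb).trans ?_
  simp only [hder]
  rfl

/-- The expected number of zeros of `M + ⟨ξ, fockAtom ·⟩`. -/
theorem IsComplexWhiteNoise.lintegral_count_zeros [IsProbabilityMeasure μ]
    (hξ : IsComplexWhiteNoise μ ξ) {M : ℂ → ℂ} (hM : Differentiable ℂ M) {A : Set ℂ}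
    (hA : MeasurableSet A) (hb : Bornology.IsBounded A) :
    ∫⁻ ω, count {w | M w + ξ ω (fockAtom w) = 0} A ∂μ =
      ∫⁻ w in A, ENNReal.ofReal ((1 + Real.exp (-Real.pi * ‖w‖ ^ 2) *
        ‖deriv M w - Real.pi * star w * M w‖ ^ 2 / Real.pi) *
          Real.exp (-(‖M w‖ ^ 2 * Real.exp (-Real.pi * ‖w‖ ^ 2)))) := by
  rw [hξ.lintegral_count_zeros_eq_lintegral_lintegral hM hA hb]
  have hF' : Measurable fun p : Ω × ℂ => ξ p.1 (fockAtomDeriv p.2) :=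
    (measurable_uncurry_of_continuous_of_measurable (u := fun w ω => ξ ω (fockAtomDeriv w))
      (fun ω => continuous_apply_fockAtomDeriv (ξ ω))
      (fun w => hξ.measurable_apply _)).comp measurable_swap
  have hF : Measurable fun p : Ω × ℂ => ξ p.1 (fockAtom p.2 - fockAtom 0) :=
    (measurable_uncurry_of_continuous_of_measurable (u := fun w ω => ξ ω (fockAtom w - fockAtom 0))
      (fun ω => (orthogonalNoise (ξ ω)).2.continuous)
      (fun w => hξ.measurable_apply _)).comp measurable_swap
  have hMc : Measurable fun p : Ω × ℂ => M p.2 := hM.continuous.measurable.comp measurable_snd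
  have hMd : Measurable fun p : Ω × ℂ => deriv M p.2 := (measurable_deriv M).comp measurable_snd
  have hmeas : Measurable fun p : Ω × ℂ =>
      ENNReal.ofReal (‖deriv M p.2 + ξ p.1 (fockAtomDeriv p.2)‖ ^ 2) *
        ENNReal.ofReal (cgaussPDF 1 (M p.2 + ξ p.1 (fockAtom p.2 - fockAtom 0))) :=
    ((hMd.add hF').norm.pow_const 2).ennreal_ofReal.mul
      ((measurable_ofReal_cgaussPDF 1).comp (hMc.add hF))
  rw [lintegral_lintegral_swap hmeas.aemeasurable]
  -- The regression on the orthogonal component degenerates at the single point `w = 0`.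
  have h0 : ∀ᵐ w ∂(volume : Measure ℂ), w ≠ 0 := by
    simp [ae_iff]
  exact lintegral_congr_ae (ae_restrict_of_ae
    (h0.mono fun w hw => hξ.lintegral_jacobian hw _ _))

theorem measurable_count_zeros_noise (hξ : IsComplexWhiteNoise μ ξ) {M : ℂ → ℂ}
    (hM : Differentiable ℂ M) {A : Set ℂ} (hA : MeasurableSet A) (hb : Bornology.IsBounded A) :
    Measurable fun ω => count {w | M w + ξ ω (fockAtom w) = 0} A :=
  measurable_count_zeros (G := fun ω w => M w + ξ ω (fockAtom w))
    (fun _ => measurable_const.add (hξ.measurable_apply _))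
    (fun ω => hM.add (differentiable_apply_fockAtom (ξ ω))) hA hb

theorem count_preimage_star (Z A : Set ℂ) : count (star ⁻¹' Z) A = count Z (star ⁻¹' A) := by
  have h : star ⁻¹' Z ∩ A = star '' (Z ∩ star ⁻¹' A) := by
    ext z
    constructor
    · rintro ⟨h1, h2⟩
      exact ⟨star z, ⟨h1, by simpa using h2⟩, star_star z⟩
    · rintro ⟨w, ⟨h1, h2⟩, rfl⟩
      exact ⟨by simpa using h1, h2⟩
  rw [count, count, h, star_injective.encard_image]

/-- The zeros of the noisy spectrogram are the conjugates of the zeros of a random entire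
function. -/
theorem setOf_specGen_noisySignal_eq_zero (x : ℝ → ℂ) (u : 𝓢'(ℝ, ℂ)) :
    {z : ℂ | specGen (noisySignal x u) z = 0} =
      star ⁻¹' {w | toFunctional x (fockAtom w) + u (fockAtom w) = 0} := by
  ext z
  simp only [specGen, noisySignal, Set.mem_ofPred_eq, Set.mem_preimage]
  rw [gaborAtom_eq_smul, toFunctional_smul, map_smul, smul_eq_mul, ← mul_add]
  simp [gaborFactor_ne_zero]

theorem spec_eq_fockSpec (x : ℝ → ℂ) :
    spec x = fockSpec fun w => toFunctional x (fockAtom w) := by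
  rw [← specGen_toFunctional]
  funext z
  rw [specGen, gaborAtom_eq_smul, toFunctional_smul, norm_mul, mul_pow, norm_gaborFactor_sq,
    fockSpec, mul_comm]

theorem measurePreserving_star : MeasurePreserving (star : ℂ → ℂ) volume volume :=
  Complex.conjLIE.measurePreserving

theorem measurableEmbedding_star : MeasurableEmbedding (star : ℂ → ℂ) :=
  Complex.conjLIE.toHomeomorph.measurableEmbedding

end

end SpectrogramZeros

open SpectrogramZeros

theorem proposition1 {Ω : Type*} [MeasurableSpace Ω] (μ : Measure Ω) [IsProbabilityMeasure μ]
    (ξ : Ω → 𝓢'(ℝ, ℂ)) (hξ : SpectrogramZeros.IsComplexWhiteNoise μ ξ)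
    (x : ℝ → ℂ) (hx_loc : LocallyIntegrable x volume)
    (hx : ∀ τ : ℝ, Integrable
      (fun t : ℝ => x t * (SpectrogramZeros.gaussWindow (t - τ) : ℂ)) volume) :
    ContDiff ℝ 2 (SpectrogramZeros.spec x) ∧
    Continuous (fun z : ℂ =>
      (1 + SpectrogramZeros.spec x z +
          Laplacian.laplacian (SpectrogramZeros.spec x) z / (4 * Real.pi)) *
        Real.exp (-SpectrogramZeros.spec x z)) ∧
    SpectrogramZeros.IsIntensity μ
      (fun ω => {z : ℂ | SpectrogramZeros.specGen (SpectrogramZeros.noisySignal x (ξ ω)) z = 0})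
      (fun z : ℂ =>
        (1 + SpectrogramZeros.spec x z +
            Laplacian.laplacian (SpectrogramZeros.spec x) z / (4 * Real.pi)) *
          Real.exp (-SpectrogramZeros.spec x z)) := by
  have hM := differentiable_toFunctional_fockAtom hx_loc hx
  simp only [spec_eq_fockSpec, setOf_specGen_noisySignal_eq_zero]
  set M : ℂ → ℂ := fun w => toFunctional x (fockAtom w) with hMdef
  let Z : Ω → Set ℂ := fun ω => {w | M w + ξ ω (fockAtom w) = 0}
  simp only [intensity_fockSpec hM]
  set ρ : ℂ → ℝ := fun z => (1 + Real.exp (-Real.pi * ‖z‖ ^ 2) *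
    ‖deriv M (star z) - Real.pi * z * M (star z)‖ ^ 2 / Real.pi) *
      Real.exp (-fockSpec M z) with hρ
  have hSc : ContDiff ℝ 2 (fockSpec M) := contDiff_fockSpec hM
  have hdc : Continuous (deriv M) := (hM.contDiff (n := 1)).continuous_deriv le_rfl
  have hMc := hM.continuous
  have hρc : Continuous ρ := by
    have := hSc.continuous
    fun_prop
  have hρ0 : ∀ z, 0 ≤ ρ z := fun z => by
    have := Real.pi_pos
    positivity
  have hbs : ∀ A : Set ℂ, Bornology.IsBounded A → Bornology.IsBounded (star ⁻¹' A) := fun A hA => by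
    have : star ⁻¹' A = star '' A := by
      ext z
      exact ⟨fun h => ⟨star z, h, star_star z⟩, by rintro ⟨w, h, rfl⟩; simpa using h⟩
    rw [this]
    exact Complex.conjLIE.lipschitz.isBounded_image hA
  have hms : ∀ A : Set ℂ, MeasurableSet A → MeasurableSet (star ⁻¹' A) := fun A hA =>
    measurePreserving_star.measurable hA
  have hint : ∀ A : Set ℂ, Bornology.IsBounded A → IntegrableOn ρ A volume := fun A hA => by
    obtain ⟨R, hR⟩ := hA.subset_closedBall 0
    exact (hρc.continuousOn.integrableOn_compact (isCompact_closedBall 0 R)).mono_set hR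
  refine ⟨hSc, hρc, ⟨hρ0, fun A hA hb => ?_, fun A _ hb => hint A hb, fun A hA hb => ?_⟩⟩
  · change AEMeasurable (fun ω => count (star ⁻¹' Z ω) A) μ
    simp only [count_preimage_star]
    exact (measurable_count_zeros_noise hξ hM (hms A hA) (hbs A hb)).aemeasurable
  · change ∫⁻ ω, count (star ⁻¹' Z ω) A ∂μ = _
    simp only [count_preimage_star]
    rw [hξ.lintegral_count_zeros hM (hms A hA) (hbs A hb),
      ofReal_integral_eq_lintegral_ofReal (hint A hb) (Filter.Eventually.of_forall hρ0),
      ← measurePreserving_star.setLIntegral_comp_preimage_emb measurableEmbedding_star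
        (fun z => ENNReal.ofReal (ρ z)) A]
    refine lintegral_congr fun w => ?_
    simp only [hρ, fockSpec, star_star, norm_star]
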